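/- Let $\Theta\subset\mathbb R$ be an interval, $I_1,I_2\subset\mathbb R$, and let $(\varphi_t)_{t\in\Theta}$ be maps from $I_1$ to $I_2$. Let $a,b\in\Theta$, $\theta\in{]a;b[}$, and let $(\varepsilon_n)_{n\ge 0}$ be i.i.d. real random variables with values in $I_1$ (almost surely); $\varepsilon$ denotes a variable with the common law. Put $X_n=\varphi_\theta(\varepsilon_n)$, and write $\partial,\partial^2$ for the first and second derivatives with respect to $t\in\Theta$ (one-sided at end points of $\Theta$). Assume: (A1) for every $t\in\Theta$, $\varphi_t$ is an increasing bijection from $I_1$ to $I_2$; (A2) for every $x\in I_2$, $t\mapsto\varphi_t^{-1}(x)$ is continuously differentiable on $\Theta$; (A3) for every $t\in\Theta$, $\mathbb E[(\varphi_t^{-1}\circ\varphi_\theta(\varepsilon))^2]<\infty$; (A4) for every compact $B\subset\Theta$, $\mathbb E[\sup_{t\in B}|\partial\varphi_t^{-1}\circ\varphi_\theta(\varepsilon)|^4]<\infty$; (A5) with $M(t)=\mathbb E[|\varphi_t^{-1}\circ\varphi_\theta(\varepsilon)-\varepsilon|^2]$ for $t\in\Theta$, one has $(t-\theta)M'(t)>0$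 for every $t\in[a;b]$ with $t\ne\theta$; (A6) for every $x\in I_2$, $t\mapsto\varphi_t^{-1}(x)$ is twice differentiable on $\Theta$, and for every compact $B\subset\Theta$, $\mathbb E[\sup_{t\in B}|\partial^2\varphi_t^{-1}\circ\varphi_\theta(\varepsilon)|^2]<\infty$. Let $\pi_{[a;b]}$ be the projection of $\mathbb R$ onto $[a;b]$, let $\widehat\theta_0\in[a;b]$ be deterministic, and for $n\ge0$ let $$\widehat\theta_{n+1}=\pi_{[a;b]}\bigl(\widehat\theta_n-\gamma_{n+1}T_{n+1}\bigr),\qquad T_{n+1}=-2\,\partial\varphi_{\widehat\theta_n}^{-1}(X_{n+1})\bigl(\varepsilon_{n+1}-\varphi_{\widehat\theta_n}^{-1}(X_{n+1})\bigr),\qquad \gamma_n=\frac1n.$$ Suppose in addition that $M''(\theta)>1/2$ and that there is $\alpha>4$ such that $\mathbb E[\sup_{t\in B}|\partial\varphi_t^{-1}\circ\varphi_\theta(\varepsilon)|^\alpha]<\infty$ for every compact $B\subset\Theta$. Then, as $n\to\infty$, $\sqrt n\,(\widehat\theta_n-\theta)$ converges in law to $\delta_0$. If moreover (A7) $M''(t)\ge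 1/2$ for every $t\in[a;b]$, then for every $n\ge0$ $$\mathbb E\bigl[(\widehat\theta_n-\theta)^2\bigr]\le(\widehat\theta_0-\theta)^2\,\frac{\exp(C_1\pi^2/6)}{n+1},\qquad C_1=4\,\mathbb E\Bigl[\sup_{t\in[a;b]}|\partial\varphi_t^{-1}\circ\varphi_\theta(\varepsilon)|^4\Bigr].$$ -/

import Mathlib

open MeasureTheory ProbabilityTheory Filter Set
open scoped ENNReal Topology

noncomputable section

namespace WarpRM

/-- The inverse `φ_t⁻¹ : I₂ → I₁` of the deformation `φ_t : I₁ → I₂`, evaluated at `x`. -/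
def inv (I₁ : Set ℝ) (φ : ℝ → ℝ → ℝ) (t x : ℝ) : ℝ :=
  Function.invFunOn (φ t) I₁ x

/-- `∂φ_t⁻¹(x)`: the derivative of `t ↦ φ_t⁻¹(x)` on the interval `Θ`
(one-sided at an end point of `Θ` that belongs to `Θ`). -/
def dInv (Θ I₁ : Set ℝ) (φ : ℝ → ℝ → ℝ) (t x : ℝ) : ℝ :=
  derivWithin (fun s => inv I₁ φ s x) Θ t

/-- `∂²φ_t⁻¹(x)`: the second derivative of `t ↦ φ_t⁻¹(x)` on `Θ`. -/
def d2Inv (Θ I₁ : Set ℝ) (φ : ℝ → ℝ → ℝ) (t x : ℝ) : ℝ :=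
  derivWithin (fun s => dInv Θ I₁ φ s x) Θ t

/-- `M(t) = E[|φ_t⁻¹(φ_θ(ξ)) - ξ|²]` where `ξ` is a random variable on `(Ω, μ)`. -/
def contrast {Ω : Type*} [MeasurableSpace Ω] (μ : Measure Ω) (I₁ : Set ℝ)
    (φ : ℝ → ℝ → ℝ) (θ : ℝ) (ξ : Ω → ℝ) (t : ℝ) : ℝ :=
  ∫ ω, |inv I₁ φ t (φ θ (ξ ω)) - ξ ω| ^ 2 ∂μ

/-- `M'`, the derivative of `M` on `Θ`. -/
def dContrast {Ω : Type*} [MeasurableSpace Ω] (μ : Measure Ω) (Θ I₁ : Set ℝ)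
    (φ : ℝ → ℝ → ℝ) (θ : ℝ) (ξ : Ω → ℝ) (t : ℝ) : ℝ :=
  derivWithin (contrast μ I₁ φ θ ξ) Θ t

/-- `M''`, the second derivative of `M` on `Θ`. -/
def d2Contrast {Ω : Type*} [MeasurableSpace Ω] (μ : Measure Ω) (Θ I₁ : Set ℝ)
    (φ : ℝ → ℝ → ℝ) (θ : ℝ) (ξ : Ω → ℝ) (t : ℝ) : ℝ :=
  derivWithin (dContrast μ Θ I₁ φ θ ξ) Θ t

/-- `E[sup_{t ∈ B} |g_t(Y)|^p]`, with values in `[0, ∞]`. -/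
def supMoment {Ω : Type*} [MeasurableSpace Ω] (μ : Measure Ω) (g : ℝ → ℝ → ℝ)
    (Y : Ω → ℝ) (B : Set ℝ) (p : ℝ) : ℝ≥0∞ :=
  ∫⁻ ω, ⨆ t ∈ B, ‖g t (Y ω)‖ₑ ^ p ∂μ

/-- The projection of `ℝ` onto `[a, b]`. -/
def proj (a b x : ℝ) : ℝ := max a (min b x)

/-- The increment `T = -2 ∂φ_s⁻¹(X) (e - φ_s⁻¹(X))` with `X = φ_θ(e)`, at the current
value `s` of the estimator and the new noise value `e`. -/
def increment (Θ I₁ : Set ℝ) (φ : ℝ → ℝ → ℝ) (θ s e : ℝ) : ℝ :=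
  -2 * dInv Θ I₁ φ s (φ θ e) * (e - inv I₁ φ s (φ θ e))

/-- The projected Robbins-Monro algorithm with steps `γ`, started at `x₀`:
`θ̂_0 = x₀` and `θ̂_{n+1} = π_{[a,b]}(θ̂_n - γ_{n+1} T_{n+1})`. -/
def estimator {Ω : Type*} (Θ I₁ : Set ℝ) (φ : ℝ → ℝ → ℝ) (θ a b : ℝ) (γ : ℕ → ℝ)
    (x₀ : ℝ) (ε : ℕ → Ω → ℝ) : ℕ → Ω → ℝ
  | 0, _ => x₀
  | n + 1, ω =>
      proj a b (estimator Θ I₁ φ θ a b γ x₀ ε n ω -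
        γ (n + 1) * increment Θ I₁ φ θ (estimator Θ I₁ φ θ a b γ x₀ ε n ω) (ε (n + 1) ω))

end WarpRM

end

set_option linter.unusedSectionVars false

/-! At the true parameter `φ_θ⁻¹(X) = ε`, so the increment `T` vanishes there: the noise is
multiplicative, which is why the limit is degenerate instead of Gaussian. By the mean value
inequality `E[T²] ≤ C (t - θ)²` at the current value `t`, where `C = 4 E[sup |∂φ_t⁻¹(X)|⁴]`, and
differentiation under the integral gives `E[T] = M'(t)`.

Suppose `(t - θ) M'(t) ≥ c (t - θ)²`. Expanding the square, conditioning on the past and using `1 +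
x ≤ exp x`, step `k` multiplies the mean square error by at most `exp (-2c/k + C/k²)`. Since `∑ 1/k
≥ log (n + 1)` and `∑ 1/k² ≤ π²/6`, the product is at most `exp (C π²/6) (n + 1)^(-2c)`
(`decay_le`). Under (A7), `M'(θ) = 0` and `M'' ≥ 1/2` allow `c = 1/2`, which is the second claim.

For the first claim, compactness gives only some `c > 0` on all of `[a, b]`, while `M''(θ) > 1/2`
gives a rate `m > 1/2` within some distance `δ` of `θ`. The global rate makes the error at a late
time `N` small in mean square, and a maximal inequality (`sq_mul_measureReal_compl_staysClose_le`)
then makes it unlikely that the algorithm ever leaves the `δ`-neighbourhood after `N`. On the event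
of never having left, the rate `m` applies, and `n` times the mean square error tends to `0` because
`2m > 1`. Convergence in probability to `0` follows, hence convergence in law. -/

namespace WarpRM

/-! ### Projected Robbins-Monro recursion with noise vanishing at the target. -/

section RobbinsMonro

variable {Ω E : Type*} [mΩ : MeasurableSpace Ω] [mE : MeasurableSpace E]

theorem proj_mem {a b : ℝ} (hab : a ≤ b) (x : ℝ) : proj a b x ∈ Icc a b :=
  ⟨le_max_left _ _, max_le hab (min_le_left _ _)⟩

theorem proj_eq_self {a b x : ℝ} (hx : x ∈ Icc a b) : proj a b x = x := by
  rw [proj, min_eq_right hx.2, max_eq_right hx.1]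

theorem continuous_proj (a b : ℝ) : Continuous (proj a b) := by
  unfold proj; fun_prop

theorem sq_proj_sub_le {a b θ : ℝ} (hθ : θ ∈ Icc a b) (x : ℝ) :
    (proj a b x - θ) ^ 2 ≤ (x - θ) ^ 2 := by
  obtain ⟨h1, h2⟩ := hθ
  unfold proj
  rcases le_total b x with hx | hx
  · rw [min_eq_left hx, max_eq_right (h1.trans h2)]
    nlinarith
  · rw [min_eq_right hx]
    rcases le_total a x with hx' | hx'
    · rw [max_eq_right hx']
    · rw [max_eq_left hx']
      nlinarith

/-- The projected Robbins-Monro algorithm with field `H`, driven by the noise `ξ`. -/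
def robbinsMonro (a b : ℝ) (γ : ℕ → ℝ) (H : ℝ → E → ℝ) (x₀ : ℝ) (ξ : ℕ → Ω → E) : ℕ → Ω → ℝ
  | 0, _ => x₀
  | n + 1, ω =>
      proj a b (robbinsMonro a b γ H x₀ ξ n ω -
        γ (n + 1) * H (robbinsMonro a b γ H x₀ ξ n ω) (ξ (n + 1) ω))

theorem robbinsMonro_mem {a b : ℝ} {γ : ℕ → ℝ} {H : ℝ → E → ℝ} {x₀ : ℝ} {ξ : ℕ → Ω → E}
    (hab : a ≤ b) (hx₀ : x₀ ∈ Icc a b) (n : ℕ) (ω : Ω) :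
    robbinsMonro a b γ H x₀ ξ n ω ∈ Icc a b := by
  cases n with
  | zero => exact hx₀
  | succ n => exact proj_mem hab _

/-- The σ-algebra generated by the noise up to time `n`. -/
@[reducible] def past (ξ : ℕ → Ω → E) (n : ℕ) : MeasurableSpace Ω :=
  ⨆ i ∈ Iic n, mE.comap (ξ i)

theorem past_le {ξ : ℕ → Ω → E} (hξ : ∀ n, Measurable (ξ n)) (n : ℕ) : past ξ n ≤ mΩ :=
  iSup₂_le fun i _ => (hξ i).comap_le

theorem past_mono (ξ : ℕ → Ω → E) : Monotone (past ξ) := fun _ _ hmn =>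
  biSup_mono fun _ hi => le_trans hi hmn

theorem measurable_past (ξ : ℕ → Ω → E) (n : ℕ) : Measurable[past ξ n] (ξ n) :=
  measurable_iff_comap_le.2
    (le_iSup₂_of_le (f := fun i (_ : i ∈ Iic n) => mE.comap (ξ i)) n (mem_Iic.2 le_rfl) le_rfl)

theorem measurable_robbinsMonro {a b : ℝ} {γ : ℕ → ℝ} {H : ℝ → E → ℝ} {x₀ : ℝ} {ξ : ℕ → Ω → E}
    (hH : Measurable (Function.uncurry H)) (n : ℕ) :
    Measurable[past ξ n] (robbinsMonro a b γ H x₀ ξ n) := by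
  induction n with
  | zero => exact measurable_const
  | succ n ih =>
    have h1 : Measurable[past ξ (n + 1)] (robbinsMonro a b γ H x₀ ξ n) :=
      ih.mono (past_mono ξ n.le_succ) le_rfl
    have h2 : Measurable[past ξ (n + 1)] fun ω =>
        H (robbinsMonro a b γ H x₀ ξ n ω) (ξ (n + 1) ω) :=
      hH.comp (h1.prodMk (measurable_past ξ (n + 1)))
    exact (continuous_proj a b).measurable.comp (h1.sub (h2.const_mul (γ (n + 1))))

theorem indepFun_of_measurable_past {μ : Measure Ω} {ξ : ℕ → Ω → E} (hξ : ∀ n, Measurable (ξ n))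
    (hindep : iIndepFun ξ μ) {β : Type*} [MeasurableSpace β] {n : ℕ} {U : Ω → β}
    (hU : Measurable[past ξ n] U) : IndepFun U (ξ (n + 1)) μ := by
  have h := indep_iSup_of_disjoint (fun i => (hξ i).comap_le) hindep
    (S := Iic n) (T := {n + 1}) (by simp)
  rw [IndepFun_iff_Indep]
  refine indep_of_indep_of_le_left (indep_of_indep_of_le_right h ?_) hU.comap_le
  simp

/-- Tonelli for the product law of `(U, X)`. It plays the role of conditioning on the past: `U` is
frozen and only the fresh noise is averaged. -/
theorem lintegral_comp_of_indepFun {μ : Measure Ω} [IsProbabilityMeasure μ] {ν : Measure E}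
    {β : Type*} [MeasurableSpace β] {U : Ω → β} {X : Ω → E} (hU : Measurable U) (hX : Measurable X)
    (h : IndepFun U X μ) (hν : μ.map X = ν) {G : β × E → ℝ≥0∞} (hG : Measurable G) :
    ∫⁻ ω, G (U ω, X ω) ∂μ = ∫⁻ ω, ∫⁻ e, G (U ω, e) ∂ν ∂μ := by
  have hp := (indepFun_iff_map_prod_eq_prod_map_map hU.aemeasurable hX.aemeasurable).1 h
  have : IsProbabilityMeasure ν := hν ▸ Measure.isProbabilityMeasure_map hX.aemeasurable
  rw [← lintegral_map (f := G) hG (hU.prodMk hX), hp, hν, lintegral_prod _ hG.aemeasurable,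
    lintegral_map hG.lintegral_prod_right' hU]

/-- One step of the algorithm contracts the mean square error from a fixed current value. -/
theorem lintegral_sq_step_le {ν : Measure E} [IsProbabilityMeasure ν] {f : E → ℝ}
    (hf : Measurable f) {u c C γ : ℝ} (hC : 0 ≤ C) (hγ : 0 ≤ γ)
    (h2 : ∫⁻ e, ENNReal.ofReal (f e ^ 2) ∂ν ≤ ENNReal.ofReal (C * u ^ 2))
    (h1 : c * u ^ 2 ≤ u * ∫ e, f e ∂ν) :
    ∫⁻ e, ENNReal.ofReal ((u - γ * f e) ^ 2) ∂ν ≤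
      ENNReal.ofReal (Real.exp (-2 * c * γ + C * γ ^ 2) * u ^ 2) := by
  have hsq : Integrable (fun e => f e ^ 2) ν := by
    refine ⟨(hf.pow_const 2).aestronglyMeasurable, ?_⟩
    rw [hasFiniteIntegral_iff_ofReal (ae_of_all _ fun e => sq_nonneg _)]
    exact h2.trans_lt ENNReal.ofReal_lt_top
  have hL2 : MemLp f 2 ν := (memLp_two_iff_integrable_sq hf.aestronglyMeasurable).2 hsq
  have hint : Integrable f ν := hL2.integrable (by norm_num)
  have hI2 : ∫ e, f e ^ 2 ∂ν ≤ C * u ^ 2 := by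
    rw [← ofReal_integral_eq_lintegral_ofReal hsq (ae_of_all _ fun e => sq_nonneg _)] at h2
    exact (ENNReal.ofReal_le_ofReal_iff (by positivity)).1 h2
  have hexp : ∀ e, (u - γ * f e) ^ 2 = (u ^ 2 - 2 * u * γ * f e) + γ ^ 2 * f e ^ 2 :=
    fun e => by ring
  have hint1 : Integrable (fun e => u ^ 2 - 2 * u * γ * f e) ν :=
    (integrable_const _).sub (hint.const_mul _)
  have hint2 : Integrable (fun e => γ ^ 2 * f e ^ 2) ν := hsq.const_mul _
  have hint3 : Integrable (fun e => (u - γ * f e) ^ 2) ν := by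
    simp_rw [hexp]; exact hint1.add hint2
  rw [← ofReal_integral_eq_lintegral_ofReal hint3 (ae_of_all _ fun e => sq_nonneg _)]
  apply ENNReal.ofReal_le_ofReal
  simp_rw [hexp]
  rw [integral_add hint1 hint2, integral_sub (integrable_const _) (hint.const_mul _),
    integral_const_mul, integral_const_mul]
  simp only [integral_const, probReal_univ, smul_eq_mul, one_mul]
  -- The expanded square is at most `(1 - 2cγ + Cγ²) u²`, and `1 + x ≤ exp x` makes the factors easy
  -- to multiply.
  have h3 := Real.add_one_le_exp (-2 * c * γ + C * γ ^ 2)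
  have h4 := mul_le_mul_of_nonneg_right h3 (sq_nonneg u)
  have h5 := mul_le_mul_of_nonneg_left h1 hγ
  have h6 := mul_le_mul_of_nonneg_left hI2 (sq_nonneg γ)
  nlinarith

/-- The one-step contraction holds for each frozen past value, and projecting only brings the
iterate closer to `θ`. The pull is required only on the past event `A`, so that a rate valid merely
near `θ` can be used. -/
theorem setIntegral_sq_step_le {μ : Measure Ω} [IsProbabilityMeasure μ] {ν : Measure E}
    {ξ : ℕ → Ω → E} (hξ : ∀ n, Measurable (ξ n)) (hindep : iIndepFun ξ μ)
    (hlaw : ∀ n, μ.map (ξ n) = ν) {H : ℝ → E → ℝ} (hH : Measurable (Function.uncurry H))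
    {a b θ C γ c : ℝ} (hθ : θ ∈ Icc a b) (hC : 0 ≤ C) (hγ : 0 ≤ γ)
    (h2 : ∀ t ∈ Icc a b, ∫⁻ e, ENNReal.ofReal (H t e ^ 2) ∂ν ≤ ENNReal.ofReal (C * (t - θ) ^ 2))
    {n : ℕ} {Z : Ω → ℝ} (hZ : Measurable[past ξ n] Z) (hZm : ∀ ω, Z ω ∈ Icc a b)
    {A : Set Ω} (hA : MeasurableSet[past ξ n] A)
    (h1 : ∀ ω ∈ A, c * (Z ω - θ) ^ 2 ≤ (Z ω - θ) * ∫ e, H (Z ω) e ∂ν) :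
    ∫ ω in A, (proj a b (Z ω - γ * H (Z ω) (ξ (n + 1) ω)) - θ) ^ 2 ∂μ ≤
      Real.exp (-2 * c * γ + C * γ ^ 2) * ∫ ω in A, (Z ω - θ) ^ 2 ∂μ := by
  have : IsProbabilityMeasure ν :=
    hlaw 0 ▸ Measure.isProbabilityMeasure_map (hξ 0).aemeasurable
  have hle := past_le hξ n
  have hAm : MeasurableSet A := hle _ hA
  have hZ' : Measurable Z := hZ.mono hle le_rfl
  -- The indicator of `A` travels as a second coordinate of the past, so that it is frozen together
  -- with `Z`.
  have hU : Measurable[past ξ n] fun ω => (Z ω, A.indicator (fun _ => (1 : ℝ≥0∞)) ω) :=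
    hZ.prodMk (measurable_const.indicator hA)
  have hH' : ∀ t, Measurable (H t) := fun t => hH.of_uncurry_left
  set Y : Ω → ℝ := fun ω => Z ω - γ * H (Z ω) (ξ (n + 1) ω) with hY
  have hYm : Measurable Y :=
    hZ'.sub ((hH.comp (hZ'.prodMk (hξ (n + 1)))).const_mul γ)
  have hG : Measurable fun p : (ℝ × ℝ≥0∞) × E =>
      p.1.2 * ENNReal.ofReal ((p.1.1 - θ - γ * H p.1.1 p.2) ^ 2) := by
    have : Measurable fun p : (ℝ × ℝ≥0∞) × E => H p.1.1 p.2 :=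
      hH.comp ((measurable_fst.comp measurable_fst).prodMk measurable_snd)
    fun_prop
  have key := lintegral_comp_of_indepFun (hU.mono hle le_rfl) (hξ (n + 1))
    (indepFun_of_measurable_past hξ hindep hU) (hlaw (n + 1)) hG
  have hVm : Measurable fun ω => (Z ω - θ) ^ 2 := by fun_prop
  have hWm : Measurable fun ω => (proj a b (Y ω) - θ) ^ 2 :=
    (((continuous_proj a b).measurable.comp hYm).sub_const θ).pow_const 2
  have hbd : ∀ x ∈ Icc a b, (x - θ) ^ 2 ≤ (b - a) ^ 2 := fun x hx => by
    obtain ⟨h1, h2⟩ := hx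
    obtain ⟨h3, h4⟩ := hθ
    exact sq_le_sq' (by linarith) (by linarith)
  have hab : a ≤ b := hθ.1.trans hθ.2
  have hVi : Integrable (fun ω => (Z ω - θ) ^ 2) μ :=
    Integrable.of_bound hVm.aestronglyMeasurable ((b - a) ^ 2) (ae_of_all _ fun ω => by
      rw [Real.norm_of_nonneg (sq_nonneg _)]; exact hbd _ (hZm ω))
  have hWi : Integrable (fun ω => (proj a b (Y ω) - θ) ^ 2) μ :=
    Integrable.of_bound hWm.aestronglyMeasurable ((b - a) ^ 2) (ae_of_all _ fun ω => by
      rw [Real.norm_of_nonneg (sq_nonneg _)]; exact hbd _ (proj_mem hab _))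
  -- In `ℝ≥0∞` the unprojected square can be integrated without first proving it integrable.
  rw [← ENNReal.ofReal_le_ofReal_iff (by positivity), ENNReal.ofReal_mul (Real.exp_pos _).le,
    ofReal_integral_eq_lintegral_ofReal hVi.integrableOn (ae_of_all _ fun ω => sq_nonneg _),
    ofReal_integral_eq_lintegral_ofReal hWi.integrableOn (ae_of_all _ fun ω => sq_nonneg _),
    ← lintegral_const_mul' _ _ ENNReal.ofReal_ne_top]
  calc ∫⁻ ω in A, ENNReal.ofReal ((proj a b (Y ω) - θ) ^ 2) ∂μ
      ≤ ∫⁻ ω in A, ENNReal.ofReal ((Z ω - θ - γ * H (Z ω) (ξ (n + 1) ω)) ^ 2) ∂μ := by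
        refine lintegral_mono fun ω => ENNReal.ofReal_le_ofReal ?_
        refine (sq_proj_sub_le hθ (Y ω)).trans (le_of_eq ?_)
        simp only [hY]; ring
    _ = ∫⁻ ω, A.indicator (fun _ => (1 : ℝ≥0∞)) ω *
          ENNReal.ofReal ((Z ω - θ - γ * H (Z ω) (ξ (n + 1) ω)) ^ 2) ∂μ := by
        rw [← lintegral_indicator hAm]
        refine lintegral_congr fun ω => ?_
        by_cases h : ω ∈ A <;> simp [h]
    _ = ∫⁻ ω, ∫⁻ e, A.indicator (fun _ => (1 : ℝ≥0∞)) ω *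
          ENNReal.ofReal ((Z ω - θ - γ * H (Z ω) e) ^ 2) ∂ν ∂μ := key
    _ ≤ ∫⁻ ω, A.indicator (fun ω => ENNReal.ofReal (Real.exp (-2 * c * γ + C * γ ^ 2)) *
          ENNReal.ofReal ((Z ω - θ) ^ 2)) ω ∂μ := by
        refine lintegral_mono fun ω => ?_
        by_cases h : ω ∈ A
        · simp only [h, indicator_of_mem, one_mul]
          rw [← ENNReal.ofReal_mul (Real.exp_pos _).le]
          exact lintegral_sq_step_le (hH' _) hC hγ (h2 _ (hZm ω)) (h1 ω h)
        · simp [h]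
    _ = _ := lintegral_indicator hAm _

/-- The factor `∏_{k ≤ n} exp (-2 c / k + C / k²)` by which `n` steps contract the mean square
error. -/
noncomputable def decay (C c : ℝ) (n : ℕ) : ℝ :=
  ∏ k ∈ Finset.range n, Real.exp (-2 * c * (1 / ((k + 1 : ℕ) : ℝ)) + C * (1 / ((k + 1 : ℕ) : ℝ)) ^ 2)

theorem decay_pos (C c : ℝ) (n : ℕ) : 0 < decay C c n :=
  Finset.prod_pos fun _ _ => Real.exp_pos _

theorem decay_succ (C c : ℝ) (n : ℕ) : decay C c (n + 1) =
    Real.exp (-2 * c * (1 / ((n + 1 : ℕ) : ℝ)) + C * (1 / ((n + 1 : ℕ) : ℝ)) ^ 2) * decay C c n := by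
  rw [decay, Finset.prod_range_succ, mul_comm]; rfl

theorem sum_one_div_sq_le (n : ℕ) :
    ∑ k ∈ Finset.range n, (1 / ((k + 1 : ℕ) : ℝ)) ^ 2 ≤ Real.pi ^ 2 / 6 := by
  have h := hasSum_zeta_two
  have h1 := h.summable.sum_le_tsum (Finset.range (n + 1)) fun i _ => by positivity
  rw [h.tsum_eq, Finset.sum_range_succ'] at h1
  simpa using h1

theorem log_le_sum_one_div (n : ℕ) :
    Real.log ((n : ℝ) + 1) ≤ ∑ k ∈ Finset.range n, 1 / ((k + 1 : ℕ) : ℝ) := by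
  have h := log_add_one_le_harmonic n
  simpa [harmonic] using h

/-- The harmonic sum yields the power of `n + 1`; the convergent sum of `1/k²` costs only a
constant. -/
theorem decay_le {C c : ℝ} (hC : 0 ≤ C) (hc : 0 ≤ c) (n : ℕ) :
    decay C c n ≤ Real.exp (C * Real.pi ^ 2 / 6) * ((n : ℝ) + 1) ^ (-(2 * c)) := by
  have hn : (0 : ℝ) < (n : ℝ) + 1 := by positivity
  rw [decay, ← Real.exp_sum, Finset.sum_add_distrib, ← Finset.mul_sum, ← Finset.mul_sum,
    Real.rpow_def_of_pos hn, ← Real.exp_add]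
  apply Real.exp_le_exp.2
  have h1 := mul_le_mul_of_nonneg_left (sum_one_div_sq_le n) hC
  have h2 := mul_le_mul_of_nonneg_left (log_le_sum_one_div n) (mul_nonneg zero_le_two hc)
  nlinarith

theorem tendsto_decay {C c : ℝ} (hC : 0 ≤ C) (hc : 0 < c) :
    Tendsto (decay C c) atTop (𝓝 0) := by
  have h : Tendsto (fun n : ℕ => Real.exp (C * Real.pi ^ 2 / 6) * ((n : ℝ) + 1) ^ (-(2 * c))) atTop
      (𝓝 (Real.exp (C * Real.pi ^ 2 / 6) * 0)) :=
    ((tendsto_rpow_neg_atTop (by positivity)).comp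
      (tendsto_atTop_add_const_right _ _ tendsto_natCast_atTop_atTop)).const_mul _
  rw [mul_zero] at h
  exact squeeze_zero (fun n => (decay_pos C c n).le) (decay_le hC hc.le) h

theorem tendsto_mul_decay {C c : ℝ} (hC : 0 ≤ C) (hc : 1 / 2 < c) :
    Tendsto (fun n : ℕ => (n : ℝ) * decay C c n) atTop (𝓝 0) := by
  have h : Tendsto (fun n : ℕ => Real.exp (C * Real.pi ^ 2 / 6) * ((n : ℝ) + 1) ^ (-(2 * c - 1)))
      atTop (𝓝 (Real.exp (C * Real.pi ^ 2 / 6) * 0)) :=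
    ((tendsto_rpow_neg_atTop (by linarith)).comp
      (tendsto_atTop_add_const_right _ _ tendsto_natCast_atTop_atTop)).const_mul _
  rw [mul_zero] at h
  refine squeeze_zero (fun n => mul_nonneg n.cast_nonneg (decay_pos C c n).le) (fun n => ?_) h
  have hn : (0 : ℝ) < (n : ℝ) + 1 := by positivity
  calc (n : ℝ) * decay C c n
      ≤ ((n : ℝ) + 1) * (Real.exp (C * Real.pi ^ 2 / 6) * ((n : ℝ) + 1) ^ (-(2 * c))) :=
        mul_le_mul (by linarith) (decay_le hC (by linarith) n) (decay_pos C c n).le hn.le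
    _ = _ := by
        rw [show -(2 * c - 1) = 1 + -(2 * c) by ring, Real.rpow_add hn, Real.rpow_one]; ring

/-- Removing from `A` a part on which `V ≥ κ` costs at least `κ` times its measure. -/
theorem setIntegral_add_measureReal_compl_le {μ : Measure Ω} [IsFiniteMeasure μ] {A B : Set Ω}
    (hA : MeasurableSet A) (hB : MeasurableSet B) (hBA : B ⊆ A) {V : Ω → ℝ} (hV : Integrable V μ)
    {κ : ℝ} (h : ∀ ω ∈ A \ B, κ ≤ V ω) :
    ∫ ω in B, V ω ∂μ + κ * μ.real Bᶜ ≤ ∫ ω in A, V ω ∂μ + κ * μ.real Aᶜ := by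
  have h1 : ∫ ω in A, V ω ∂μ = ∫ ω in A \ B, V ω ∂μ + ∫ ω in B, V ω ∂μ := by
    rw [← setIntegral_union disjoint_sdiff_left hB hV.integrableOn hV.integrableOn,
      sdiff_union_of_subset hBA]
  have h2 : μ.real Bᶜ = μ.real Aᶜ + μ.real (A \ B) := by
    rw [← measureReal_union (disjoint_compl_left.mono_right sdiff_subset) (hA.diff hB)]
    congr 1
    ext ω
    have := @hBA ω
    simp only [mem_compl_iff, mem_union, Set.mem_sdiff]
    tauto
  have h3 : κ * μ.real (A \ B) ≤ ∫ ω in A \ B, V ω ∂μ := by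
    have := setIntegral_ge_of_const_le_real (hA.diff hB) (measure_ne_top _ _) h hV.integrableOn
    simpa [mul_comm] using this
  rw [h1, h2]; linarith

/-! ### Mean square decay, maximal inequality and rate of convergence. -/

section Algorithm

variable {μ : Measure Ω} [IsProbabilityMeasure μ] {ν : Measure E} {ξ : ℕ → Ω → E}
  {H : ℝ → E → ℝ} {a b θ C x₀ : ℝ}

theorem integrable_sq_robbinsMonro (hξ : ∀ n, Measurable (ξ n))
    (hH : Measurable (Function.uncurry H)) (hab : a ≤ b) (hx₀ : x₀ ∈ Icc a b) (γ : ℕ → ℝ) (n : ℕ) :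
    Integrable (fun ω => (robbinsMonro a b γ H x₀ ξ n ω - θ) ^ 2) μ := by
  have hm : Measurable (robbinsMonro a b γ H x₀ ξ n) :=
    (measurable_robbinsMonro hH n).mono (past_le hξ n) le_rfl
  obtain ⟨K, hK⟩ := (isCompact_Icc (a := a) (b := b)).exists_bound_of_continuousOn
    (f := fun x : ℝ => (x - θ) ^ 2) (by fun_prop)
  exact Integrable.of_bound ((hm.sub_const θ).pow_const 2).aestronglyMeasurable K
    (ae_of_all _ fun ω => hK _ (robbinsMonro_mem hab hx₀ n ω))

theorem setIntegral_sq_robbinsMonro_succ_le (hξ : ∀ n, Measurable (ξ n)) (hindep : iIndepFun ξ μ)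
    (hlaw : ∀ n, μ.map (ξ n) = ν) (hH : Measurable (Function.uncurry H)) (hθ : θ ∈ Icc a b)
    (hC : 0 ≤ C) (hx₀ : x₀ ∈ Icc a b)
    (h2 : ∀ t ∈ Icc a b, ∫⁻ e, ENNReal.ofReal (H t e ^ 2) ∂ν ≤ ENNReal.ofReal (C * (t - θ) ^ 2))
    {n : ℕ} {A : Set Ω} (hA : MeasurableSet[past ξ n] A) {c : ℝ}
    (h1 : ∀ ω ∈ A, c * (robbinsMonro a b (fun n => 1 / (n : ℝ)) H x₀ ξ n ω - θ) ^ 2 ≤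
      (robbinsMonro a b (fun n => 1 / (n : ℝ)) H x₀ ξ n ω - θ) *
        ∫ e, H (robbinsMonro a b (fun n => 1 / (n : ℝ)) H x₀ ξ n ω) e ∂ν) :
    ∫ ω in A, (robbinsMonro a b (fun n => 1 / (n : ℝ)) H x₀ ξ (n + 1) ω - θ) ^ 2 ∂μ ≤
      Real.exp (-2 * c * (1 / ((n + 1 : ℕ) : ℝ)) + C * (1 / ((n + 1 : ℕ) : ℝ)) ^ 2) *
        ∫ ω in A, (robbinsMonro a b (fun n => 1 / (n : ℝ)) H x₀ ξ n ω - θ) ^ 2 ∂μ :=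
  setIntegral_sq_step_le hξ hindep hlaw hH hθ hC (by positivity) h2
    (measurable_robbinsMonro hH n) (robbinsMonro_mem (hθ.1.trans hθ.2) hx₀ n) hA h1

/-- If the field pulls towards `θ` at rate `c` as long as the algorithm stays in the decreasing
sequence of events `A`, then the mean square error on `A` decays accordingly. -/
theorem decay_mul_setIntegral_le (hξ : ∀ n, Measurable (ξ n)) (hindep : iIndepFun ξ μ)
    (hlaw : ∀ n, μ.map (ξ n) = ν) (hH : Measurable (Function.uncurry H)) (hθ : θ ∈ Icc a b)
    (hC : 0 ≤ C) (hx₀ : x₀ ∈ Icc a b)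
    (h2 : ∀ t ∈ Icc a b, ∫⁻ e, ENNReal.ofReal (H t e ^ 2) ∂ν ≤ ENNReal.ofReal (C * (t - θ) ^ 2))
    {A : ℕ → Set Ω} (hA : ∀ n, MeasurableSet[past ξ n] (A n)) (hanti : Antitone A) {c : ℝ} {N : ℕ}
    (h1 : ∀ n ≥ N, ∀ ω ∈ A n, c * (robbinsMonro a b (fun n => 1 / (n : ℝ)) H x₀ ξ n ω - θ) ^ 2 ≤
      (robbinsMonro a b (fun n => 1 / (n : ℝ)) H x₀ ξ n ω - θ) *
        ∫ e, H (robbinsMonro a b (fun n => 1 / (n : ℝ)) H x₀ ξ n ω) e ∂ν) {n : ℕ} (hn : N ≤ n) :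
    decay C c N * ∫ ω in A n, (robbinsMonro a b (fun n => 1 / (n : ℝ)) H x₀ ξ n ω - θ) ^ 2 ∂μ ≤
      decay C c n *
        ∫ ω in A N, (robbinsMonro a b (fun n => 1 / (n : ℝ)) H x₀ ξ N ω - θ) ^ 2 ∂μ := by
  induction n, hn using Nat.le_induction with
  | base => exact le_rfl
  | succ n hn ih =>
    have hab := hθ.1.trans hθ.2
    have hstep := setIntegral_sq_robbinsMonro_succ_le hξ hindep hlaw hH hθ hC hx₀ h2 (hA n) (h1 n hn)
    have hmono : ∫ ω in A (n + 1),
          (robbinsMonro a b (fun n => 1 / (n : ℝ)) H x₀ ξ (n + 1) ω - θ) ^ 2 ∂μ ≤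
        ∫ ω in A n, (robbinsMonro a b (fun n => 1 / (n : ℝ)) H x₀ ξ (n + 1) ω - θ) ^ 2 ∂μ :=
      setIntegral_mono_set (integrable_sq_robbinsMonro hξ hH hab hx₀ _ _).integrableOn
        (ae_of_all _ fun ω => sq_nonneg _) (hanti n.le_succ).eventuallyLE
    calc _ ≤ decay C c N * (Real.exp (-2 * c * (1 / ((n + 1 : ℕ) : ℝ)) +
              C * (1 / ((n + 1 : ℕ) : ℝ)) ^ 2) *
            ∫ ω in A n, (robbinsMonro a b (fun n => 1 / (n : ℝ)) H x₀ ξ n ω - θ) ^ 2 ∂μ) :=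
          mul_le_mul_of_nonneg_left (hmono.trans hstep) (decay_pos C c N).le
      _ = Real.exp (-2 * c * (1 / ((n + 1 : ℕ) : ℝ)) + C * (1 / ((n + 1 : ℕ) : ℝ)) ^ 2) *
            (decay C c N *
              ∫ ω in A n, (robbinsMonro a b (fun n => 1 / (n : ℝ)) H x₀ ξ n ω - θ) ^ 2 ∂μ) := by
          ring
      _ ≤ _ := by
          rw [decay_succ, mul_assoc (Real.exp _)]
          exact mul_le_mul_of_nonneg_left ih (Real.exp_pos _).le

theorem integral_sq_robbinsMonro_le (hξ : ∀ n, Measurable (ξ n)) (hindep : iIndepFun ξ μ)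
    (hlaw : ∀ n, μ.map (ξ n) = ν) (hH : Measurable (Function.uncurry H)) (hθ : θ ∈ Icc a b)
    (hC : 0 ≤ C) (hx₀ : x₀ ∈ Icc a b)
    (h2 : ∀ t ∈ Icc a b, ∫⁻ e, ENNReal.ofReal (H t e ^ 2) ∂ν ≤ ENNReal.ofReal (C * (t - θ) ^ 2))
    {c : ℝ} (h1 : ∀ t ∈ Icc a b, c * (t - θ) ^ 2 ≤ (t - θ) * ∫ e, H t e ∂ν) (n : ℕ) :
    ∫ ω, (robbinsMonro a b (fun n => 1 / (n : ℝ)) H x₀ ξ n ω - θ) ^ 2 ∂μ ≤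
      decay C c n * (x₀ - θ) ^ 2 := by
  have h := decay_mul_setIntegral_le hξ hindep hlaw hH hθ hC hx₀ h2 (A := fun _ => univ)
    (fun _ => MeasurableSet.univ) (fun _ _ _ => le_rfl) (N := 0) (c := c)
    (fun n _ ω _ => h1 _ (robbinsMonro_mem (hθ.1.trans hθ.2) hx₀ n ω)) n.zero_le
  simpa [decay, robbinsMonro] using h

/-- The event that the algorithm stays within distance `δ` of `θ` between the times `N` and `n`. -/
def staysClose (Z : ℕ → Ω → ℝ) (θ δ : ℝ) (N n : ℕ) : Set Ω :=
  {ω | ∀ k ∈ Icc N n, (Z k ω - θ) ^ 2 ≤ δ ^ 2}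

theorem measurableSet_staysClose (hH : Measurable (Function.uncurry H)) (γ : ℕ → ℝ) (δ : ℝ)
    (N n : ℕ) :
    MeasurableSet[past ξ n] (staysClose (robbinsMonro a b γ H x₀ ξ) θ δ N n) := by
  have : staysClose (robbinsMonro a b γ H x₀ ξ) θ δ N n =
      ⋂ k ∈ Icc N n, {ω | (robbinsMonro a b γ H x₀ ξ k ω - θ) ^ 2 ≤ δ ^ 2} := by
    ext; simp [staysClose]
  rw [this]
  refine MeasurableSet.biInter (to_countable _) fun k hk => ?_
  have hm : Measurable[past ξ n] (robbinsMonro a b γ H x₀ ξ k) :=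
    (measurable_robbinsMonro hH k).mono (past_mono ξ hk.2) le_rfl
  exact measurableSet_le ((hm.sub_const θ).pow_const 2) measurable_const

theorem staysClose_antitone (Z : ℕ → Ω → ℝ) (θ δ : ℝ) (N : ℕ) :
    Antitone (staysClose Z θ δ N) :=
  fun _ _ hmn _ hω k hk => hω k ⟨hk.1, hk.2.trans hmn⟩

/-- A maximal inequality for the algorithm. -/
theorem sq_mul_measureReal_compl_staysClose_le (hξ : ∀ n, Measurable (ξ n))
    (hindep : iIndepFun ξ μ) (hlaw : ∀ n, μ.map (ξ n) = ν) (hH : Measurable (Function.uncurry H))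
    (hθ : θ ∈ Icc a b) (hC : 0 ≤ C) (hx₀ : x₀ ∈ Icc a b)
    (h2 : ∀ t ∈ Icc a b, ∫⁻ e, ENNReal.ofReal (H t e ^ 2) ∂ν ≤ ENNReal.ofReal (C * (t - θ) ^ 2))
    (h1 : ∀ t ∈ Icc a b, 0 ≤ (t - θ) * ∫ e, H t e ∂ν) (δ : ℝ) {N n : ℕ} (hn : N ≤ n) :
    δ ^ 2 * μ.real
        (staysClose (robbinsMonro a b (fun n => 1 / (n : ℝ)) H x₀ ξ) θ δ N n)ᶜ ≤
      Real.exp (C * Real.pi ^ 2 / 6) *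
        ∫ ω, (robbinsMonro a b (fun n => 1 / (n : ℝ)) H x₀ ξ N ω - θ) ^ 2 ∂μ := by
  have hab := hθ.1.trans hθ.2
  set Z := robbinsMonro a b (fun n => 1 / (n : ℝ)) H x₀ ξ with hZ
  have hA : ∀ n, MeasurableSet[past ξ n] (staysClose Z θ δ N n) :=
    measurableSet_staysClose hH _ δ N
  have hA' : ∀ n, MeasurableSet (staysClose Z θ δ N n) := fun n => past_le hξ n _ (hA n)
  have hint : ∀ n, Integrable (fun ω => (Z n ω - θ) ^ 2) μ :=
    integrable_sq_robbinsMonro hξ hH hab hx₀ _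
  have hone : ∀ n, 1 ≤ decay C 0 n := fun n => by
    rw [decay, ← Real.exp_sum]
    refine Real.one_le_exp (Finset.sum_nonneg fun k _ => ?_)
    simp only [mul_zero, zero_mul, zero_add]
    positivity
  -- The error on the paths still close, plus `δ²` for each path that has left, is almost a
  -- supermartingale: with pull rate `0`, it grows at each step by a factor at most `exp (C/k²)`.
  have key : decay C 0 N * (∫ ω in staysClose Z θ δ N n, (Z n ω - θ) ^ 2 ∂μ +
      δ ^ 2 * μ.real (staysClose Z θ δ N n)ᶜ) ≤ decay C 0 n * ∫ ω, (Z N ω - θ) ^ 2 ∂μ := by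
    induction n, hn using Nat.le_induction with
    | base =>
      refine mul_le_mul_of_nonneg_left ?_ (decay_pos C 0 N).le
      have := setIntegral_add_measureReal_compl_le (κ := δ ^ 2) MeasurableSet.univ (hA' N)
        (subset_univ _) (hint N) fun ω hω => by
          by_contra! hlt
          refine hω.2 fun k hk => ?_
          rw [le_antisymm hk.2 hk.1]
          exact hlt.le
      simpa using this
    | succ n hn ih =>
      -- A path leaving exactly at time `n + 1` has squared error above `δ²` then, which pays for
      -- its exit.
      have h3 := setIntegral_add_measureReal_compl_le (κ := δ ^ 2) (hA' n) (hA' (n + 1))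
        (staysClose_antitone Z θ δ N n.le_succ) (hint (n + 1)) fun ω hω => by
          by_contra! hlt
          refine hω.2 fun k hk => ?_
          rcases hk.2.eq_or_lt with rfl | hk'
          · exact hlt.le
          · exact hω.1 k ⟨hk.1, Nat.lt_succ_iff.1 hk'⟩
      have h4 := setIntegral_sq_robbinsMonro_succ_le hξ hindep hlaw hH hθ hC hx₀ h2 (hA n) (c := 0)
        fun ω _ => by
          rw [zero_mul]; exact h1 _ (robbinsMonro_mem hab hx₀ n ω)
      have h5 : δ ^ 2 * μ.real (staysClose Z θ δ N n)ᶜ ≤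
          Real.exp (-2 * 0 * (1 / ((n + 1 : ℕ) : ℝ)) + C * (1 / ((n + 1 : ℕ) : ℝ)) ^ 2) *
            (δ ^ 2 * μ.real (staysClose Z θ δ N n)ᶜ) := by
        refine le_mul_of_one_le_left (by positivity) (Real.one_le_exp ?_)
        simp only [mul_zero, zero_mul, zero_add]
        positivity
      have h6 := h3.trans (add_le_add h4 h5)
      rw [← mul_add] at h6
      calc _ ≤ decay C 0 N * _ := mul_le_mul_of_nonneg_left h6 (decay_pos C 0 N).le
        _ = Real.exp (-2 * 0 * (1 / ((n + 1 : ℕ) : ℝ)) + C * (1 / ((n + 1 : ℕ) : ℝ)) ^ 2) *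
            (decay C 0 N * (∫ ω in staysClose Z θ δ N n, (Z n ω - θ) ^ 2 ∂μ +
              δ ^ 2 * μ.real (staysClose Z θ δ N n)ᶜ)) := by ring
        _ ≤ _ := by
          rw [decay_succ, mul_assoc (Real.exp _)]
          exact mul_le_mul_of_nonneg_left ih (Real.exp_pos _).le
  have h7 : decay C 0 n ≤ Real.exp (C * Real.pi ^ 2 / 6) := by
    simpa using decay_le hC le_rfl n
  have h8 : 0 ≤ ∫ ω in staysClose Z θ δ N n, (Z n ω - θ) ^ 2 ∂μ :=
    integral_nonneg fun ω => sq_nonneg _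
  have h9 : 0 ≤ δ ^ 2 * μ.real (staysClose Z θ δ N n)ᶜ := by positivity
  have h10 : 0 ≤ ∫ ω, (Z N ω - θ) ^ 2 ∂μ := integral_nonneg fun ω => sq_nonneg _
  calc _ ≤ ∫ ω in staysClose Z θ δ N n, (Z n ω - θ) ^ 2 ∂μ +
        δ ^ 2 * μ.real (staysClose Z θ δ N n)ᶜ := by linarith
    _ ≤ decay C 0 N * (∫ ω in staysClose Z θ δ N n, (Z n ω - θ) ^ 2 ∂μ +
        δ ^ 2 * μ.real (staysClose Z θ δ N n)ᶜ) :=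
      le_mul_of_one_le_left (by positivity) (hone N)
    _ ≤ _ := key
    _ ≤ _ := mul_le_mul_of_nonneg_right h7 h10

/-- If the field pulls towards `θ` at some rate everywhere and at a rate larger than `1/2` close
to `θ`, then the error of the algorithm with steps `1/n` is `o(1/√n)` in probability. -/
theorem tendstoInMeasure_sqrt_mul_robbinsMonro (hξ : ∀ n, Measurable (ξ n))
    (hindep : iIndepFun ξ μ) (hlaw : ∀ n, μ.map (ξ n) = ν) (hH : Measurable (Function.uncurry H))
    (hθ : θ ∈ Icc a b) (hC : 0 ≤ C) (hx₀ : x₀ ∈ Icc a b)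
    (h2 : ∀ t ∈ Icc a b, ∫⁻ e, ENNReal.ofReal (H t e ^ 2) ∂ν ≤ ENNReal.ofReal (C * (t - θ) ^ 2))
    {c : ℝ} (hc : 0 < c) (h1 : ∀ t ∈ Icc a b, c * (t - θ) ^ 2 ≤ (t - θ) * ∫ e, H t e ∂ν)
    {m δ : ℝ} (hm : 1 / 2 < m) (hδ : 0 < δ)
    (hloc : ∀ t ∈ Icc a b, |t - θ| ≤ δ → m * (t - θ) ^ 2 ≤ (t - θ) * ∫ e, H t e ∂ν) :
    TendstoInMeasure μ (fun (n : ℕ) ω =>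
      √(n : ℝ) * (robbinsMonro a b (fun n => 1 / (n : ℝ)) H x₀ ξ n ω - θ)) atTop fun _ => 0 := by
  have hab := hθ.1.trans hθ.2
  have hI := integral_sq_robbinsMonro_le hξ hindep hlaw hH hθ hC hx₀ h2 h1
  have hmax := fun N n (hn : N ≤ n) => sq_mul_measureReal_compl_staysClose_le hξ hindep hlaw hH hθ
    hC hx₀ h2 (fun t ht => (mul_nonneg hc.le (sq_nonneg _)).trans (h1 t ht)) δ hn
  have hAm : ∀ N n, MeasurableSet[past ξ n] (staysClose
      (robbinsMonro a b (fun n => 1 / (n : ℝ)) H x₀ ξ) θ δ N n) :=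
    fun N n => measurableSet_staysClose hH _ δ N n
  have hdec := fun N n (hn : N ≤ n) => decay_mul_setIntegral_le hξ hindep hlaw hH hθ hC hx₀ h2
    (hAm N) (staysClose_antitone _ θ δ N) (c := m) (N := N) (fun n hn ω hω =>
      hloc _ (robbinsMonro_mem hab hx₀ n ω)
        (abs_le_of_sq_le_sq (hω n ⟨hn, le_rfl⟩) hδ.le)) hn
  set Z := robbinsMonro a b (fun n => 1 / (n : ℝ)) H x₀ ξ with hZ
  have hint : ∀ n, Integrable (fun ω => (Z n ω - θ) ^ 2) μ :=
    integrable_sq_robbinsMonro hξ hH hab hx₀ _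
  rw [tendstoInMeasure_iff_measureReal_norm]
  intro η hη
  rw [Metric.tendsto_atTop]
  intro r hr
  set K := Real.exp (C * Real.pi ^ 2 / 6) with hK
  have hlim1 : Tendsto (fun N => K * (decay C c N * (x₀ - θ) ^ 2)) atTop (𝓝 0) := by
    simpa using ((tendsto_decay hC hc).mul_const ((x₀ - θ) ^ 2)).const_mul K
  -- `N` is fixed first, by the global rate `c`, so that leaving after `N` has probability below `r
  -- / 2`; `n₀` then comes from the local rate `m`.
  obtain ⟨N, hN⟩ := (hlim1.eventually (gt_mem_nhds
    (show (0 : ℝ) < δ ^ 2 * (r / 2) by positivity))).exists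
  set J := ∫ ω in staysClose Z θ δ N N, (Z N ω - θ) ^ 2 ∂μ with hJ
  have hlim2 : Tendsto (fun n : ℕ => (n : ℝ) * decay C m n * J) atTop (𝓝 0) := by
    simpa using (tendsto_mul_decay hC hm).mul_const J
  obtain ⟨n₀, hn₀⟩ := eventually_atTop.1 (hlim2.eventually (gt_mem_nhds
    (show (0 : ℝ) < decay C m N * (η ^ 2 * (r / 2)) from
      mul_pos (decay_pos _ _ _) (by positivity))))
  refine ⟨max N n₀, fun n hn => ?_⟩
  have hNn : N ≤ n := (le_max_left _ _).trans hn
  rw [dist_zero_right, Real.norm_of_nonneg measureReal_nonneg]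
  have hfar : μ.real (staysClose Z θ δ N n)ᶜ < r / 2 := by
    have h3 := (hmax N n hNn).trans (mul_le_mul_of_nonneg_left (hI N) (Real.exp_pos _).le)
    exact lt_of_mul_lt_mul_left (h3.trans_lt hN) (sq_nonneg δ)
  have hclose : (μ.restrict (staysClose Z θ δ N n)).real
      {ω | η ^ 2 ≤ n * (Z n ω - θ) ^ 2} < r / 2 := by
    have h3 := mul_meas_ge_le_integral_of_nonneg (μ := μ.restrict (staysClose Z θ δ N n))
      (f := fun ω => (n : ℝ) * (Z n ω - θ) ^ 2) (ae_of_all _ fun ω => by positivity)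
      ((hint n).integrableOn.const_mul _) (η ^ 2)
    rw [integral_const_mul] at h3
    have h4 := mul_le_mul_of_nonneg_left (hdec N n hNn) (Nat.cast_nonneg (α := ℝ) n)
    have h5 := hn₀ n ((le_max_right _ _).trans hn)
    have h6 := mul_le_mul_of_nonneg_left h3 (decay_pos C m N).le
    have h7 : decay C m N * (η ^ 2 * (μ.restrict (staysClose Z θ δ N n)).real
      {ω | η ^ 2 ≤ n * (Z n ω - θ) ^ 2}) < decay C m N * (η ^ 2 * (r / 2)) := by
      refine h6.trans_lt (lt_of_le_of_lt ?_ h5)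
      calc _ = (n : ℝ) * (decay C m N * ∫ ω in staysClose Z θ δ N n, (Z n ω - θ) ^ 2 ∂μ) := by ring
        _ ≤ _ := h4
        _ = _ := by rw [hJ]; ring
    exact lt_of_mul_lt_mul_left (lt_of_mul_lt_mul_left h7 (decay_pos C m N).le) (sq_nonneg η)
  have hset : {ω | η ≤ ‖√(n : ℝ) * (Z n ω - θ) - 0‖} = {ω | η ^ 2 ≤ n * (Z n ω - θ) ^ 2} := by
    ext ω
    simp only [mem_ofPred_eq, sub_zero, Real.norm_eq_abs]
    rw [← pow_le_pow_iff_left₀ hη.le (abs_nonneg _) two_ne_zero, sq_abs, mul_pow,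
      Real.sq_sqrt n.cast_nonneg]
  have hS : MeasurableSet (staysClose Z θ δ N n) := past_le hξ n _ (hAm N n)
  rw [hset]
  rw [measureReal_restrict_apply' hS] at hclose
  calc _ ≤ μ.real (({ω | η ^ 2 ≤ n * (Z n ω - θ) ^ 2} ∩ staysClose Z θ δ N n) ∪
        (staysClose Z θ δ N n)ᶜ) := measureReal_mono fun ω hω => by
          by_cases h : ω ∈ staysClose Z θ δ N n
          · exact Or.inl ⟨hω, h⟩
          · exact Or.inr h
    _ ≤ _ := measureReal_union_le _ _
    _ < r := by linarith

end Algorithm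

end RobbinsMonro

/-! ### Differentiating the contrast and bounding the increments. -/

section Contrast

variable {Ω : Type*} [MeasurableSpace Ω] {μ : Measure Ω} [IsProbabilityMeasure μ]
  {f f' : ℝ → Ω → ℝ} {c d θ : ℝ}

theorem exists_enorm_le_of_continuousOn {g : ℝ → ℝ} (hcd : c ≤ d) (hg : ContinuousOn g (Icc c d)) :
    ∃ t₀ ∈ Icc c d, ∀ t ∈ Icc c d, ‖g t‖ₑ ≤ ‖g t₀‖ₑ :=
  isCompact_Icc.exists_isMaxOn (nonempty_Icc.2 hcd) hg.enorm

theorem enorm_rpow_four (x : ℝ) : ‖x‖ₑ ^ (4 : ℝ) = ENNReal.ofReal (x ^ 4) := by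
  rw [Real.enorm_eq_ofReal_abs, ENNReal.ofReal_rpow_of_nonneg (abs_nonneg x) (by norm_num)]
  congr 1
  rw [show (4 : ℝ) = ((4 : ℕ) : ℝ) by norm_num, Real.rpow_natCast]
  exact Even.pow_abs (by decide) x

theorem abs_sub_le_of_hasDerivWithinAt {g g' : ℝ → ℝ} {K : ℝ}
    (hder : ∀ t ∈ Icc c d, HasDerivWithinAt g (g' t) (Icc c d) t)
    (hK : ∀ t ∈ Icc c d, |g' t| ≤ K) {s t : ℝ} (hs : s ∈ Icc c d) (ht : t ∈ Icc c d) :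
    |g s - g t| ≤ K * |s - t| :=
  (convex_Icc c d).norm_image_sub_le_of_norm_hasDerivWithin_le hder hK ht hs

/-- An uncountable supremum need not be visibly measurable. By continuity in `t`, the supremum over
a dense sequence is the same and is measurable; `x² ≤ 1 + x⁴` then gives square integrability. -/
theorem exists_sq_integrable_bound (hcd : c ≤ d) (hfm' : ∀ t ∈ Icc c d, Measurable (f' t))
    (hcont : ∀ ω, ContinuousOn (fun t => f' t ω) (Icc c d))
    (hsup : ∫⁻ ω, ⨆ t ∈ Icc c d, ‖f' t ω‖ₑ ^ (4 : ℝ) ∂μ < ∞) :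
    ∃ S : Ω → ℝ, Integrable (fun ω => S ω ^ 2) μ ∧ ∀ ω, ∀ t ∈ Icc c d, |f' t ω| ≤ S ω := by
  have : Nonempty (Icc c d) := (nonempty_Icc.2 hcd).to_subtype
  set u := TopologicalSpace.denseSeq (Icc c d)
  set T : Ω → ℝ≥0∞ := fun ω => ⨆ n, ‖f' (u n) ω‖ₑ with hT
  have hTm : Measurable T := Measurable.iSup fun n => (hfm' _ (u n).2).enorm
  have hbd : ∀ ω, ∃ t₀ ∈ Icc c d, T ω ≤ ‖f' t₀ ω‖ₑ := fun ω => by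
    obtain ⟨t₀, h0, h1⟩ := exists_enorm_le_of_continuousOn hcd (hcont ω)
    exact ⟨t₀, h0, iSup_le fun n => h1 _ (u n).2⟩
  have hfin : ∀ ω, T ω ≠ ∞ := fun ω => by
    obtain ⟨t₀, -, h1⟩ := hbd ω
    exact (h1.trans_lt enorm_lt_top).ne
  have hle : ∀ ω, ∀ t : Icc c d, ‖f' t ω‖ₑ ≤ T ω := fun ω t => by
    have hcl : IsClosed {t : Icc c d | ‖f' t ω‖ₑ ≤ T ω} :=
      isClosed_le ((continuousOn_iff_continuous_domRestrict.1 (hcont ω)).enorm) continuous_const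
    exact (TopologicalSpace.denseRange_denseSeq (Icc c d)).induction_on
      (p := fun t : Icc c d => ‖f' t ω‖ₑ ≤ T ω) t hcl
      fun n => le_iSup (fun n => ‖f' (u n) ω‖ₑ) n
  refine ⟨fun ω => (T ω).toReal, ?_, fun ω t ht => ?_⟩
  · refine ⟨(hTm.ennreal_toReal.pow_const 2).aestronglyMeasurable, ?_⟩
    rw [hasFiniteIntegral_iff_ofReal (ae_of_all _ fun ω => sq_nonneg _)]
    have h1 : ∀ ω, ENNReal.ofReal ((T ω).toReal ^ 2) ≤
        1 + ⨆ t ∈ Icc c d, ‖f' t ω‖ₑ ^ (4 : ℝ) := fun ω => by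
      obtain ⟨t₀, h0, h1⟩ := hbd ω
      have h2 : (T ω).toReal ≤ |f' t₀ ω| := by
        have := ENNReal.toReal_mono enorm_lt_top.ne h1
        simpa using this
      have h3 : (T ω).toReal ^ 2 ≤ 1 + f' t₀ ω ^ 4 := by
        have := pow_le_pow_left₀ ENNReal.toReal_nonneg h2 2
        rw [sq_abs] at this
        nlinarith [sq_nonneg (f' t₀ ω ^ 2 - 1), sq_nonneg (f' t₀ ω ^ 2)]
      refine (ENNReal.ofReal_le_ofReal h3).trans ?_
      rw [ENNReal.ofReal_add zero_le_one (by positivity), ENNReal.ofReal_one, ← enorm_rpow_four]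
      gcongr
      exact le_iSup₂ (f := fun t (_ : t ∈ Icc c d) => ‖f' t ω‖ₑ ^ (4 : ℝ)) t₀ h0
    refine (lintegral_mono h1).trans_lt ?_
    rw [lintegral_add_left measurable_const]
    simpa using hsup
  · have := ENNReal.toReal_mono (hfin ω) (hle ω ⟨t, ht⟩)
    simpa using this

/-- The mean value inequality bounds `|f t - f θ|` by `|t - θ|` times the supremum of `|f'|`. The
other factor `f' t` supplies a second supremum, whence the fourth power after squaring. -/
theorem lintegral_sq_increment_le (hcd : c ≤ d) (hθ : θ ∈ Icc c d)
    (hder : ∀ ω, ∀ t ∈ Icc c d, HasDerivWithinAt (fun s => f s ω) (f' t ω) (Icc c d) t)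
    (hcont : ∀ ω, ContinuousOn (fun t => f' t ω) (Icc c d)) {t : ℝ} (ht : t ∈ Icc c d) :
    ∫⁻ ω, ENNReal.ofReal ((2 * f' t ω * (f t ω - f θ ω)) ^ 2) ∂μ ≤
      ENNReal.ofReal (4 * (t - θ) ^ 2) * ∫⁻ ω, ⨆ t ∈ Icc c d, ‖f' t ω‖ₑ ^ (4 : ℝ) ∂μ := by
  rw [← lintegral_const_mul' _ _ ENNReal.ofReal_ne_top]
  refine lintegral_mono fun ω => ?_
  obtain ⟨t₀, h0, h1⟩ := exists_enorm_le_of_continuousOn hcd (hcont ω)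
  have h2 : ∀ t ∈ Icc c d, |f' t ω| ≤ |f' t₀ ω| := fun t ht => by
    have := ENNReal.toReal_mono enorm_lt_top.ne (h1 t ht)
    simpa using this
  have h3 := abs_sub_le_of_hasDerivWithinAt (hder ω) h2 ht hθ
  have h4 : (2 * f' t ω * (f t ω - f θ ω)) ^ 2 ≤ 4 * (t - θ) ^ 2 * f' t₀ ω ^ 4 := by
    have h5 : |f' t ω| * |f t ω - f θ ω| ≤ |f' t₀ ω| * (|f' t₀ ω| * |t - θ|) :=
      mul_le_mul (h2 t ht) h3 (abs_nonneg _) (abs_nonneg _)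
    have h6 := pow_le_pow_left₀ (by positivity) h5 2
    simp only [mul_pow, sq_abs] at h6 ⊢
    nlinarith
  refine (ENNReal.ofReal_le_ofReal h4).trans ?_
  rw [ENNReal.ofReal_mul (by positivity), ← enorm_rpow_four]
  gcongr
  exact le_iSup₂ (f := fun t (_ : t ∈ Icc c d) => ‖f' t ω‖ₑ ^ (4 : ℝ)) t₀ h0

/-- Differentiation under the integral sign for the contrast. -/
theorem hasDerivWithinAt_integral_sq (hcd : c ≤ d) (hθ : θ ∈ Icc c d)
    (hfm : ∀ t ∈ Icc c d, Measurable (f t)) (hfm' : ∀ t ∈ Icc c d, Measurable (f' t))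
    (hder : ∀ ω, ∀ t ∈ Icc c d, HasDerivWithinAt (fun s => f s ω) (f' t ω) (Icc c d) t)
    (hcont : ∀ ω, ContinuousOn (fun t => f' t ω) (Icc c d))
    (hsup : ∫⁻ ω, ⨆ t ∈ Icc c d, ‖f' t ω‖ₑ ^ (4 : ℝ) ∂μ < ∞) {t : ℝ} (ht : t ∈ Icc c d) :
    HasDerivWithinAt (fun s => ∫ ω, (f s ω - f θ ω) ^ 2 ∂μ)
      (∫ ω, 2 * f' t ω * (f t ω - f θ ω) ∂μ) (Icc c d) t := by
  obtain ⟨S, hSi, hS⟩ := exists_sq_integrable_bound hcd hfm' hcont hsup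
  have hLip : ∀ ω, ∀ s ∈ Icc c d, ∀ r ∈ Icc c d, |f s ω - f r ω| ≤ S ω * |s - r| :=
    fun ω s hs r hr => abs_sub_le_of_hasDerivWithinAt (hder ω) (hS ω) hs hr
  have hS0 : ∀ ω, 0 ≤ S ω := fun ω => (abs_nonneg _).trans (hS ω t ht)
  have hdist : ∀ s ∈ Icc c d, |s - θ| ≤ d - c := fun s hs =>
    abs_le.2 ⟨by linarith [hs.1, hθ.2], by linarith [hs.2, hθ.1]⟩
  have hqm : ∀ s ∈ Icc c d, Measurable fun ω => (f s ω - f θ ω) ^ 2 := fun s hs =>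
    ((hfm s hs).sub (hfm θ hθ)).pow_const 2
  have hqi : ∀ s ∈ Icc c d, Integrable (fun ω => (f s ω - f θ ω) ^ 2) μ := fun s hs =>
    (hSi.mul_const (|s - θ| ^ 2)).mono' (hqm s hs).aestronglyMeasurable (ae_of_all _ fun ω => by
      rw [Real.norm_of_nonneg (sq_nonneg _), ← mul_pow, ← sq_abs]
      exact pow_le_pow_left₀ (abs_nonneg _) (hLip ω s hs θ hθ) 2)
  have hmem : ∀ᶠ s in 𝓝[Icc c d \ {t}] t, s ∈ Icc c d \ {t} := self_mem_nhdsWithin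
  rw [hasDerivWithinAt_iff_tendsto_slope]
  have hslope : ∀ᶠ s in 𝓝[Icc c d \ {t}] t,
      ∫ ω, slope (fun s => (f s ω - f θ ω) ^ 2) t s ∂μ =
        slope (fun s => ∫ ω, (f s ω - f θ ω) ^ 2 ∂μ) t s := by
    filter_upwards [hmem] with s hs
    simp only [slope_def_field]
    rw [integral_div, integral_sub (hqi s hs.1) (hqi t ht)]
  refine Tendsto.congr' hslope ?_
  -- The bound comes from factoring the difference of squares: the sum is at most `2 (d - c) S`, the
  -- difference at most `S |s - t|`.
  refine tendsto_integral_filter_of_dominated_convergence (fun ω => 2 * (d - c) * S ω ^ 2) ?_ ?_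
    (hSi.const_mul _) (ae_of_all _ fun ω => ?_)
  · filter_upwards [hmem] with s hs
    simp only [slope_def_field]
    exact (((hqm s hs.1).sub (hqm t ht)).div_const _).aestronglyMeasurable
  · filter_upwards [hmem] with s hs
    refine ae_of_all _ fun ω => ?_
    have hst : 0 < |s - t| := abs_pos.2 (sub_ne_zero.2 hs.2)
    rw [slope_def_field, norm_div, Real.norm_eq_abs, Real.norm_eq_abs, div_le_iff₀ hst,
      sq_sub_sq, abs_mul]
    have h1 : |f s ω - f θ ω + (f t ω - f θ ω)| ≤ S ω * (2 * (d - c)) := by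
      refine (abs_add_le _ _).trans ?_
      have h2 := (hLip ω s hs.1 θ hθ).trans (mul_le_mul_of_nonneg_left (hdist s hs.1) (hS0 ω))
      have h3 := (hLip ω t ht θ hθ).trans (mul_le_mul_of_nonneg_left (hdist t ht) (hS0 ω))
      linarith
    have h4 : |f s ω - f θ ω - (f t ω - f θ ω)| ≤ S ω * |s - t| := by
      rw [sub_sub_sub_cancel_right]; exact hLip ω s hs.1 t ht
    calc _ ≤ S ω * (2 * (d - c)) * (S ω * |s - t|) :=
          mul_le_mul h1 h4 (abs_nonneg _) ((abs_nonneg _).trans h1)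
      _ = _ := by ring
  · rw [← hasDerivWithinAt_iff_tendsto_slope]
    refine (((hder ω t ht).sub_const (f θ ω)).pow 2).congr_deriv ?_
    push_cast
    ring

theorem continuousOn_integral_increment (hcd : c ≤ d) (hθ : θ ∈ Icc c d)
    (hfm : ∀ t ∈ Icc c d, Measurable (f t)) (hfm' : ∀ t ∈ Icc c d, Measurable (f' t))
    (hder : ∀ ω, ∀ t ∈ Icc c d, HasDerivWithinAt (fun s => f s ω) (f' t ω) (Icc c d) t)
    (hcont : ∀ ω, ContinuousOn (fun t => f' t ω) (Icc c d))
    (hsup : ∫⁻ ω, ⨆ t ∈ Icc c d, ‖f' t ω‖ₑ ^ (4 : ℝ) ∂μ < ∞) :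
    ContinuousOn (fun t => ∫ ω, 2 * f' t ω * (f t ω - f θ ω) ∂μ) (Icc c d) := by
  obtain ⟨S, hSi, hS⟩ := exists_sq_integrable_bound hcd hfm' hcont hsup
  refine continuousOn_of_dominated (bound := fun ω => 2 * (d - c) * S ω ^ 2) (fun t ht => ?_)
    (fun t ht => ae_of_all _ fun ω => ?_) (hSi.const_mul _) (ae_of_all _ fun ω => ?_)
  · exact (((hfm' t ht).const_mul 2).mul ((hfm t ht).sub (hfm θ hθ))).aestronglyMeasurable
  · have h1 := abs_sub_le_of_hasDerivWithinAt (hder ω) (hS ω) ht hθ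
    have hS0 : 0 ≤ S ω := (abs_nonneg _).trans (hS ω t ht)
    have h2 : |t - θ| ≤ d - c :=
      abs_le.2 ⟨by linarith [ht.1, hθ.2], by linarith [ht.2, hθ.1]⟩
    rw [Real.norm_eq_abs, abs_mul, abs_mul, abs_two]
    calc _ ≤ 2 * S ω * (S ω * (d - c)) := by
          refine mul_le_mul (mul_le_mul_of_nonneg_left (hS ω t ht) zero_le_two)
            (h1.trans (mul_le_mul_of_nonneg_left h2 hS0)) (abs_nonneg _) (by positivity)
      _ = _ := by ring
  · exact ((hcont ω).const_mul 2).mul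
      (ContinuousOn.sub (fun t ht => (hder ω t ht).continuousWithinAt) continuousOn_const)

end Contrast

/-- A function that vanishes at `θ` with a derivative larger than `m` grows there at least with
slope `m`. -/
theorem exists_mul_sq_le {h : ℝ → ℝ} {θ m : ℝ} (h0 : h θ = 0) {h' : ℝ}
    (hder : HasDerivAt h h' θ) (hm : m < h') :
    ∃ δ > 0, ∀ t, |t - θ| ≤ δ → m * (t - θ) ^ 2 ≤ (t - θ) * h t := by
  have h1 := (hasDerivAt_iff_tendsto_slope.1 hder).eventually (lt_mem_nhds hm)
  rw [eventually_nhdsWithin_iff, Metric.eventually_nhds_iff] at h1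
  obtain ⟨r, hr, h2⟩ := h1
  refine ⟨r / 2, by positivity, fun t ht => ?_⟩
  rcases eq_or_ne t θ with rfl | hne
  · simp
  have h3 := h2 (y := t) (by rw [Real.dist_eq]; linarith) hne
  rw [slope_def_field, h0, sub_zero] at h3
  have h4 : 0 < (t - θ) ^ 2 := by have := sub_ne_zero.2 hne; positivity
  have h5 : h t / (t - θ) * (t - θ) ^ 2 = (t - θ) * h t := by
    have := sub_ne_zero.2 hne
    field_simp
  rw [← h5]
  exact mul_le_mul_of_nonneg_right h3.le h4.le

/-- Away from `θ` the positive continuous function `(t - θ) h t` has a positive minimum `κ` by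
compactness, while `(t - θ)²` never exceeds `(b - a)²`. -/
theorem exists_global_mul_sq_le {h : ℝ → ℝ} {a b θ m δ : ℝ} (hθ : θ ∈ Ioo a b)
    (hcont : ContinuousOn h (Icc a b)) (hpos : ∀ t ∈ Icc a b, t ≠ θ → 0 < (t - θ) * h t)
    (hm : 0 < m) (hδ : 0 < δ)
    (hloc : ∀ t ∈ Icc a b, |t - θ| ≤ δ → m * (t - θ) ^ 2 ≤ (t - θ) * h t) :
    ∃ c > 0, ∀ t ∈ Icc a b, c * (t - θ) ^ 2 ≤ (t - θ) * h t := by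
  set K : Set ℝ := Icc a b ∩ {t | δ ≤ |t - θ|} with hK
  have hKc : IsCompact K :=
    isCompact_Icc.inter_right (isClosed_le continuous_const (by fun_prop))
  have hcont' : ContinuousOn (fun t => (t - θ) * h t) K :=
    (ContinuousOn.mul (by fun_prop) hcont).mono inter_subset_left
  have hba : 0 < b - a := by linarith [hθ.1, hθ.2]
  obtain ⟨κ, hκ, hκK⟩ : ∃ κ > 0, ∀ t ∈ K, κ ≤ (t - θ) * h t := by
    rcases K.eq_empty_or_nonempty with he | hne
    · exact ⟨1, one_pos, by simp [he]⟩
    · obtain ⟨t₀, h1, h2⟩ := hKc.exists_isMinOn hne hcont'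
      refine ⟨_, hpos t₀ h1.1 fun h3 => ?_, h2⟩
      have h4 : δ ≤ |t₀ - θ| := h1.2
      simp only [h3, sub_self, abs_zero] at h4
      linarith
  refine ⟨min m (κ / (b - a) ^ 2), lt_min hm (by positivity), fun t ht => ?_⟩
  rcases le_total |t - θ| δ with h1 | h1
  · exact (mul_le_mul_of_nonneg_right (min_le_left _ _) (sq_nonneg _)).trans (hloc t ht h1)
  · have h2 : (t - θ) ^ 2 ≤ (b - a) ^ 2 :=
      sq_le_sq' (by linarith [ht.1, hθ.2]) (by linarith [ht.2, hθ.1])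
    calc _ ≤ κ / (b - a) ^ 2 * (b - a) ^ 2 :=
          mul_le_mul (min_le_right _ _) h2 (sq_nonneg _) (by positivity)
      _ = κ := by field_simp
      _ ≤ _ := hκK t ⟨ht, h1⟩

/-- A function that vanishes at `θ` with derivative at least `m` grows at least with slope `m`. -/
theorem mul_sq_le_of_le_derivWithin {h h' : ℝ → ℝ} {a b θ m : ℝ} (hθ : θ ∈ Icc a b)
    (hder : ∀ t ∈ Icc a b, HasDerivWithinAt h (h' t) (Icc a b) t) (hm : ∀ t ∈ Icc a b, m ≤ h' t)
    (h0 : h θ = 0) {t : ℝ} (ht : t ∈ Icc a b) : m * (t - θ) ^ 2 ≤ (t - θ) * h t := by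
  have hder' : ∀ t ∈ interior (Icc a b), HasDerivAt h (h' t) t := fun t ht =>
    (hder t (interior_subset ht)).hasDerivAt (mem_interior_iff_mem_nhds.1 ht)
  have key := (convex_Icc a b).mul_sub_le_image_sub_of_le_deriv (f := h) (C := m)
    (fun t ht => (hder t ht).continuousWithinAt)
    (fun t ht => (hder' t ht).differentiableAt.differentiableWithinAt)
    (fun t ht => (hder' t ht).deriv ▸ hm t (interior_subset ht))
  rcases le_total θ t with hle | hle
  · have := key θ hθ t ht hle
    rw [h0] at this
    nlinarith
  · have := key t ht θ hθ hle
    rw [h0] at this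
    nlinarith

/-! ### Noise taking its values in the subtype. -/

section Noise

variable {Ω : Type*} [MeasurableSpace Ω] {μ : Measure Ω} {s : Set ℝ}

theorem iIndepFun_of_coe {ξ : ℕ → Ω → s} (h : iIndepFun (fun n ω => (ξ n ω : ℝ)) μ) :
    iIndepFun ξ μ := by
  rw [iIndepFun_iff_iIndep] at h ⊢
  convert h using 2 with n
  exact MeasurableSpace.comap_comp

theorem map_eq_of_map_coe_eq {X Y : Ω → s} (hX : Measurable X) (hY : Measurable Y)
    (h : μ.map (fun ω => (X ω : ℝ)) = μ.map (fun ω => (Y ω : ℝ))) : μ.map X = μ.map Y := by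
  ext _ ⟨B, hB, rfl⟩
  have h1 := congrArg (fun m => m B) h
  rw [Measure.map_apply hX.subtype_coe hB,
    Measure.map_apply hY.subtype_coe hB] at h1
  rw [Measure.map_apply hX (measurable_subtype_coe hB),
    Measure.map_apply hY (measurable_subtype_coe hB)]
  exact h1

/-- An i.i.d. sequence with values in `s` almost surely has a version with values in the
measurable space `s`. -/
theorem exists_iid_version [IsProbabilityMeasure μ] {ε : ℕ → Ω → ℝ} (hmeas : ∀ n, Measurable (ε n))
    (hindep : iIndepFun ε μ) (hident : ∀ n, IdentDistrib (ε n) (ε 0) μ μ)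
    (hmem : ∀ n, ∀ᵐ ω ∂μ, ε n ω ∈ s) :
    ∃ ξ : ℕ → Ω → s, (∀ n, Measurable (ξ n)) ∧ iIndepFun ξ μ ∧
      (∀ n, μ.map (ξ n) = μ.map (ξ 0)) ∧ ∀ᵐ ω ∂μ, ∀ n, ε n ω = ξ n ω := by
  have hne : s.Nonempty := by
    obtain ⟨ω, hω⟩ := (hmem 0).exists
    exact ⟨_, hω⟩
  choose g hgm hgs hge using fun n =>
    (hmeas n).aemeasurable.exists_ae_eq_range_subset (hmem n) hne
  set ξ : ℕ → Ω → s := fun n ω => ⟨g n ω, hgs n (mem_range_self ω)⟩ with hξ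
  have hξm : ∀ n, Measurable (ξ n) := fun n => (hgm n).subtype_mk
  refine ⟨ξ, hξm, iIndepFun_of_coe (hindep.congr hge), fun n => ?_, ae_all_iff.2 hge⟩
  refine map_eq_of_map_coe_eq (hξm n) (hξm 0) ?_
  exact (Measure.map_congr (hge n)).symm.trans ((hident n).map_eq.trans (Measure.map_congr (hge 0)))

end Noise

/-- Moments are controlled only on compacts, whereas derivatives are taken within `Θ`. An end point
of `Θ` serves as its own bound when nothing in `Θ` lies beyond it. -/
theorem exists_Icc_mem_nhdsWithin {Θ : Set ℝ} {t θ : ℝ} (ht : t ∈ Θ) (hθ : θ ∈ Θ) :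
    ∃ c ∈ Θ, ∃ d ∈ Θ, t ∈ Icc c d ∧ θ ∈ Icc c d ∧ Icc c d ∈ 𝓝[Θ] t := by
  have hup : ∃ d ∈ Θ, t ≤ d ∧ θ ≤ d ∧ ∀ᶠ s in 𝓝[Θ] t, s ≤ d := by
    by_cases h : ∃ d₀ ∈ Θ, t < d₀
    · obtain ⟨d₀, h1, h2⟩ := h
      refine ⟨max d₀ θ, by rcases max_choice d₀ θ with h | h <;> rw [h] <;> assumption,
        h2.le.trans (le_max_left _ _), le_max_right _ _, ?_⟩
      exact nhdsWithin_le_nhds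
        ((gt_mem_nhds h2).mono fun s hs => (show s < d₀ from hs).le.trans (le_max_left _ _))
    · push Not at h
      exact ⟨t, ht, le_rfl, h θ hθ, eventually_nhdsWithin_of_forall h⟩
  have hdown : ∃ c ∈ Θ, c ≤ t ∧ c ≤ θ ∧ ∀ᶠ s in 𝓝[Θ] t, c ≤ s := by
    by_cases h : ∃ c₀ ∈ Θ, c₀ < t
    · obtain ⟨c₀, h1, h2⟩ := h
      refine ⟨min c₀ θ, by rcases min_choice c₀ θ with h | h <;> rw [h] <;> assumption,
        (min_le_left _ _).trans h2.le, min_le_right _ _, ?_⟩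
      exact nhdsWithin_le_nhds
        ((lt_mem_nhds h2).mono fun s hs => (min_le_left _ _).trans (show c₀ < s from hs).le)
    · push Not at h
      exact ⟨t, ht, le_rfl, h θ hθ, eventually_nhdsWithin_of_forall h⟩
  obtain ⟨d, hd, h1, h2, h3⟩ := hup
  obtain ⟨c, hc, h4, h5, h6⟩ := hdown
  exact ⟨c, hc, d, hd, ⟨h4, h1⟩, ⟨h5, h2⟩, h6.and h3⟩

theorem uniqueDiffOn_of_ordConnected {Θ : Set ℝ} (hΘ : Θ.OrdConnected) {a b : ℝ} (ha : a ∈ Θ)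
    (hb : b ∈ Θ) (hab : a < b) : UniqueDiffOn ℝ Θ := by
  refine uniqueDiffOn_convex hΘ.convex ⟨(a + b) / 2, ?_⟩
  refine interior_mono (hΘ.out ha hb) ?_
  rw [interior_Icc]
  exact ⟨by linarith, by linarith⟩

/-! ### Inverse deformations: regularity in the parameter, measurability in the noise. -/

section Deformation

variable {Θ I₁ I₂ : Set ℝ} {φ : ℝ → ℝ → ℝ} {θ : ℝ}

theorem apply_inv {t x : ℝ} (h : BijOn (φ t) I₁ I₂) (hx : x ∈ I₂) : φ t (inv I₁ φ t x) = x :=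
  Function.invFunOn_eq (h.surjOn hx)

theorem inv_mem {t x : ℝ} (h : BijOn (φ t) I₁ I₂) (hx : x ∈ I₂) : inv I₁ φ t x ∈ I₁ :=
  Function.invFunOn_mem (h.surjOn hx)

theorem inv_apply {t e : ℝ} (h : BijOn (φ t) I₁ I₂) (he : e ∈ I₁) : inv I₁ φ t (φ t e) = e :=
  h.injOn.leftInvOn_invFunOn he

theorem monotoneOn_inv {t : ℝ} (h : BijOn (φ t) I₁ I₂) (hmono : StrictMonoOn (φ t) I₁) :
    MonotoneOn (inv I₁ φ t) I₂ := fun x hx y hy hxy => by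
  by_contra! hlt
  have := hmono (inv_mem h hy) (inv_mem h hx) hlt
  rw [apply_inv h hx, apply_inv h hy] at this
  exact absurd hxy this.not_ge

/-- Monotonicity alone gives measurability. It is available only on `I₁`, which is why the noise is
moved to the subtype. -/
theorem measurable_inv (hA1 : ∀ t ∈ Θ, BijOn (φ t) I₁ I₂ ∧ StrictMonoOn (φ t) I₁) (hθ : θ ∈ Θ)
    {t : ℝ} (ht : t ∈ Θ) : Measurable fun e : I₁ => inv I₁ φ t (φ θ e) :=
  Monotone.measurable fun e e' hee' =>
    monotoneOn_inv (hA1 t ht).1 (hA1 t ht).2 ((hA1 θ hθ).1.mapsTo e.2) ((hA1 θ hθ).1.mapsTo e'.2)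
      ((hA1 θ hθ).2.monotoneOn e.2 e'.2 hee')

theorem hasDerivWithinAt_inv (hA2 : ∀ x ∈ I₂, ContDiffOn ℝ 1 (fun t => inv I₁ φ t x) Θ)
    {x t : ℝ} (hx : x ∈ I₂) (ht : t ∈ Θ) :
    HasDerivWithinAt (fun s => inv I₁ φ s x) (dInv Θ I₁ φ t x) Θ t :=
  ((hA2 x hx).differentiableOn one_ne_zero t ht).hasDerivWithinAt

theorem continuousOn_dInv (hu : UniqueDiffOn ℝ Θ)
    (hA2 : ∀ x ∈ I₂, ContDiffOn ℝ 1 (fun t => inv I₁ φ t x) Θ) {x : ℝ} (hx : x ∈ I₂) :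
    ContinuousOn (fun t => dInv Θ I₁ φ t x) Θ :=
  (hA2 x hx).continuousOn_derivWithin hu le_rfl

theorem measurable_dInv (hu : UniqueDiffOn ℝ Θ)
    (hA1 : ∀ t ∈ Θ, BijOn (φ t) I₁ I₂ ∧ StrictMonoOn (φ t) I₁)
    (hA2 : ∀ x ∈ I₂, ContDiffOn ℝ 1 (fun t => inv I₁ φ t x) Θ) (hθ : θ ∈ Θ) {t : ℝ} (ht : t ∈ Θ) :
    Measurable fun e : I₁ => dInv Θ I₁ φ t (φ θ e) := by
  have : (𝓝[Θ \ {t}] t).NeBot := accPt_principal_iff_nhdsWithin.1 (hu t ht).accPt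
  -- The derivative is a limit of difference quotients; the indicator makes them measurable for
  -- every `s`, also outside `Θ`.
  refine measurable_of_tendsto_metrizable' (𝓝[Θ \ {t}] t) (f := fun s (e : I₁) =>
    Θ.indicator (slope (fun r => inv I₁ φ r (φ θ e)) t) s) (fun s => ?_) (tendsto_pi_nhds.2 fun e => ?_)
  · by_cases hs : s ∈ Θ
    · simp only [hs, indicator_of_mem, slope_def_field]
      exact ((measurable_inv hA1 hθ hs).sub (measurable_inv hA1 hθ ht)).div_const _
    · simp [hs]
  · have h := hasDerivWithinAt_iff_tendsto_slope.1
      (hasDerivWithinAt_inv hA2 ((hA1 θ hθ).1.mapsTo e.2) ht)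
    refine h.congr' (eventually_nhdsWithin_of_forall fun s hs => ?_)
    exact (indicator_of_mem hs.1 _).symm

end Deformation

/-- Continuity in `t` and measurability in `e` give joint measurability. Precomposing with the
projection keeps the parameter in `Θ`; it changes nothing along the algorithm, whose iterates lie in
`[a, b]`. -/
theorem measurable_increment_proj {Θ I₁ I₂ : Set ℝ} {φ : ℝ → ℝ → ℝ} {θ a b : ℝ}
    (hu : UniqueDiffOn ℝ Θ) (hA1 : ∀ t ∈ Θ, BijOn (φ t) I₁ I₂ ∧ StrictMonoOn (φ t) I₁)
    (hA2 : ∀ x ∈ I₂, ContDiffOn ℝ 1 (fun t => inv I₁ φ t x) Θ) (hθ : θ ∈ Θ) (hab : a ≤ b)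
    (hsub : Icc a b ⊆ Θ) :
    Measurable (Function.uncurry fun t (e : I₁) => increment Θ I₁ φ θ (proj a b t) e) := by
  have hp : ∀ t, proj a b t ∈ Θ := fun t => hsub (proj_mem hab t)
  have h1 : Measurable (Function.uncurry fun t (e : I₁) => inv I₁ φ (proj a b t) (φ θ e)) :=
    measurable_uncurry_of_continuous_of_measurable
      (fun e => (hA2 _ ((hA1 θ hθ).1.mapsTo e.2)).continuousOn.comp_continuous
        (continuous_proj a b) hp) fun t => measurable_inv hA1 hθ (hp t)
  have h2 : Measurable (Function.uncurry fun t (e : I₁) => dInv Θ I₁ φ (proj a b t) (φ θ e)) :=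
    measurable_uncurry_of_continuous_of_measurable
      (fun e => (continuousOn_dInv hu hA2 ((hA1 θ hθ).1.mapsTo e.2)).comp_continuous
        (continuous_proj a b) hp) fun t => measurable_dInv hu hA1 hA2 hθ (hp t)
  exact (h2.const_mul (-2)).mul ((measurable_subtype_coe.comp measurable_snd).sub h1)

theorem estimator_eq_robbinsMonro {Ω : Type*} [MeasurableSpace Ω] {Θ I₁ : Set ℝ} {φ : ℝ → ℝ → ℝ} {θ a b x₀ : ℝ}
    {γ : ℕ → ℝ} (hab : a ≤ b) (hx₀ : x₀ ∈ Icc a b) {ε : ℕ → Ω → ℝ} {ξ : ℕ → Ω → I₁} {ω : Ω}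
    (h : ∀ n, ε n ω = ξ n ω) (n : ℕ) :
    estimator Θ I₁ φ θ a b γ x₀ ε n ω =
      robbinsMonro a b γ (fun t (e : I₁) => increment Θ I₁ φ θ (proj a b t) e) x₀ ξ n ω := by
  induction n with
  | zero => rfl
  | succ n ih =>
    rw [estimator, robbinsMonro, ih, h, proj_eq_self (robbinsMonro_mem hab hx₀ n ω)]

theorem tendstoInDistribution_dirac_of_tendstoInMeasure {Ω : Type*} [MeasurableSpace Ω]
    {μ : Measure Ω} [IsProbabilityMeasure μ] {X : ℕ → Ω → ℝ} {x : ℝ}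
    (hX : ∀ n, AEMeasurable (X n) μ) (h : TendstoInMeasure μ X atTop fun _ => x) :
    TendstoInDistribution X atTop (id : ℝ → ℝ) (fun _ => μ) (Measure.dirac x) where
  forall_aemeasurable := hX
  aemeasurable_limit := aemeasurable_id
  tendsto := by
    convert (h.tendstoInDistribution hX).tendsto using 2
    ext1
    simp [Measure.map_const]

/-! ### Moments of the increments in terms of the contrast. -/

section MeanField

variable {Ω : Type*} [MeasurableSpace Ω] {μ : Measure Ω} [IsProbabilityMeasure μ]
  {Θ I₁ I₂ : Set ℝ} {φ : ℝ → ℝ → ℝ} {θ : ℝ} {ε₀ : Ω → ℝ} {ξ₀ : Ω → I₁}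

theorem supMoment_congr {g : ℝ → ℝ → ℝ} {Y Y' : Ω → ℝ} (h : Y =ᵐ[μ] Y') (B : Set ℝ) (p : ℝ) :
    supMoment μ g Y B p = supMoment μ g Y' B p :=
  lintegral_congr_ae (h.mono fun ω hω => by simp only [hω])

/-- The derivative of the contrast is the mean of the increments of the algorithm. -/
theorem hasDerivWithinAt_contrast (hΘ : Θ.OrdConnected) (hu : UniqueDiffOn ℝ Θ)
    (hA1 : ∀ t ∈ Θ, BijOn (φ t) I₁ I₂ ∧ StrictMonoOn (φ t) I₁)
    (hA2 : ∀ x ∈ I₂, ContDiffOn ℝ 1 (fun t => inv I₁ φ t x) Θ)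
    (hA4 : ∀ B : Set ℝ, IsCompact B → B ⊆ Θ →
      supMoment μ (dInv Θ I₁ φ) (fun ω => φ θ (ε₀ ω)) B 4 < ∞)
    (hθ : θ ∈ Θ) (hξ : Measurable ξ₀) (hε : ∀ᵐ ω ∂μ, ε₀ ω = ξ₀ ω) {t : ℝ} (ht : t ∈ Θ) :
    HasDerivWithinAt (contrast μ I₁ φ θ ε₀)
      (∫ ω, increment Θ I₁ φ θ t (ξ₀ ω) ∂μ) Θ t := by
  obtain ⟨c, hc, d, hd, htcd, hθcd, hmem⟩ := exists_Icc_mem_nhdsWithin ht hθ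
  have hsub : Icc c d ⊆ Θ := hΘ.out hc hd
  have hx : ∀ ω, φ θ (ξ₀ ω) ∈ I₂ := fun ω => (hA1 θ hθ).1.mapsTo (ξ₀ ω).2
  have hself : ∀ ω, inv I₁ φ θ (φ θ (ξ₀ ω)) = ξ₀ ω := fun ω => inv_apply (hA1 θ hθ).1 (ξ₀ ω).2
  have hsup := hA4 _ (isCompact_Icc (a := c) (b := d)) hsub
  rw [supMoment_congr (hε.mono fun ω hω => by simp only [hω] :
    (fun ω => φ θ (ε₀ ω)) =ᵐ[μ] fun ω => φ θ (ξ₀ ω))] at hsup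
  have key := hasDerivWithinAt_integral_sq (μ := μ) (f := fun t ω => inv I₁ φ t (φ θ (ξ₀ ω)))
    (f' := fun t ω => dInv Θ I₁ φ t (φ θ (ξ₀ ω))) (htcd.1.trans htcd.2) hθcd
    (fun t ht => (measurable_inv hA1 hθ (hsub ht)).comp hξ)
    (fun t ht => (measurable_dInv hu hA1 hA2 hθ (hsub ht)).comp hξ)
    (fun ω t ht => (hasDerivWithinAt_inv hA2 (hx ω) (hsub ht)).mono hsub)
    (fun ω => (continuousOn_dInv hu hA2 (hx ω)).mono hsub) hsup htcd
  -- Writing the noise as `φ_θ⁻¹(φ_θ(ξ₀))` puts the contrast in the form `E[(f t - f θ)²]`.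
  have hM : contrast μ I₁ φ θ ε₀ =
      fun s => ∫ ω, (inv I₁ φ s (φ θ (ξ₀ ω)) - inv I₁ φ θ (φ θ (ξ₀ ω))) ^ 2 ∂μ := by
    funext s
    refine integral_congr_ae (hε.mono fun ω hω => ?_)
    simp only [hω, sq_abs, hself]
  rw [hM]
  refine (key.congr_deriv ?_).mono_of_mem_nhdsWithin hmem
  refine integral_congr_ae (ae_of_all _ fun ω => ?_)
  simp only [increment, hself]
  ring

theorem continuousOn_integral_increment_noise (hu : UniqueDiffOn ℝ Θ)
    (hA1 : ∀ t ∈ Θ, BijOn (φ t) I₁ I₂ ∧ StrictMonoOn (φ t) I₁)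
    (hA2 : ∀ x ∈ I₂, ContDiffOn ℝ 1 (fun t => inv I₁ φ t x) Θ) {a b : ℝ} (hab : Icc a b ⊆ Θ)
    (hsup : supMoment μ (dInv Θ I₁ φ) (fun ω => φ θ (ξ₀ ω)) (Icc a b) 4 < ∞)
    (hθ : θ ∈ Icc a b) (hξ : Measurable ξ₀) :
    ContinuousOn (fun t => ∫ ω, increment Θ I₁ φ θ t (ξ₀ ω) ∂μ) (Icc a b) := by
  have hθ' := hab hθ
  have hx : ∀ ω, φ θ (ξ₀ ω) ∈ I₂ := fun ω => (hA1 θ hθ').1.mapsTo (ξ₀ ω).2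
  have hself : ∀ ω, inv I₁ φ θ (φ θ (ξ₀ ω)) = ξ₀ ω := fun ω => inv_apply (hA1 θ hθ').1 (ξ₀ ω).2
  have key := continuousOn_integral_increment (μ := μ) (f := fun t ω => inv I₁ φ t (φ θ (ξ₀ ω)))
    (f' := fun t ω => dInv Θ I₁ φ t (φ θ (ξ₀ ω))) (hθ.1.trans hθ.2) hθ
    (fun t ht => (measurable_inv hA1 hθ' (hab ht)).comp hξ)
    (fun t ht => (measurable_dInv hu hA1 hA2 hθ' (hab ht)).comp hξ)
    (fun ω t ht => (hasDerivWithinAt_inv hA2 (hx ω) (hab ht)).mono hab)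
    (fun ω => (continuousOn_dInv hu hA2 (hx ω)).mono hab) hsup
  refine key.congr fun t _ => integral_congr_ae (ae_of_all _ fun ω => ?_)
  simp only [increment, hself]
  ring

theorem lintegral_sq_increment_noise_le (hA1 : ∀ t ∈ Θ, BijOn (φ t) I₁ I₂ ∧ StrictMonoOn (φ t) I₁)
    (hu : UniqueDiffOn ℝ Θ) (hA2 : ∀ x ∈ I₂, ContDiffOn ℝ 1 (fun t => inv I₁ φ t x) Θ) {a b : ℝ}
    (hab : Icc a b ⊆ Θ) (hθ : θ ∈ Icc a b) {t : ℝ} (ht : t ∈ Icc a b) :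
    ∫⁻ ω, ENNReal.ofReal (increment Θ I₁ φ θ t (ξ₀ ω) ^ 2) ∂μ ≤ ENNReal.ofReal (4 * (t - θ) ^ 2) *
      supMoment μ (dInv Θ I₁ φ) (fun ω => φ θ (ξ₀ ω)) (Icc a b) 4 := by
  have hθ' := hab hθ
  have hx : ∀ ω, φ θ (ξ₀ ω) ∈ I₂ := fun ω => (hA1 θ hθ').1.mapsTo (ξ₀ ω).2
  have hself : ∀ ω, inv I₁ φ θ (φ θ (ξ₀ ω)) = ξ₀ ω := fun ω => inv_apply (hA1 θ hθ').1 (ξ₀ ω).2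
  refine le_trans (le_of_eq ?_) (lintegral_sq_increment_le (μ := μ)
    (f := fun t ω => inv I₁ φ t (φ θ (ξ₀ ω)))
    (f' := fun t ω => dInv Θ I₁ φ t (φ θ (ξ₀ ω))) (hθ.1.trans hθ.2) hθ
    (fun ω t ht => (hasDerivWithinAt_inv hA2 (hx ω) (hab ht)).mono hab)
    (fun ω => (continuousOn_dInv hu hA2 (hx ω)).mono hab) ht)
  refine lintegral_congr fun ω => ?_
  simp only [increment, hself]
  congr 1
  ring

end MeanField

end WarpRM

/-! ### The main theorem. -/

open WarpRM in
theorem theorem3p2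
    {Ω : Type*} [MeasurableSpace Ω] (μ : Measure Ω) [IsProbabilityMeasure μ]
    -- the parameter interval, the deformations and the true parameter
    (Θ I₁ I₂ : Set ℝ) (hΘ : Θ.OrdConnected) (φ : ℝ → ℝ → ℝ)
    (θ a b : ℝ) (ha : a ∈ Θ) (hb : b ∈ Θ) (hθ : θ ∈ Ioo a b)
    -- the i.i.d. noise, with values in the domain of the deformations
    (ε : ℕ → Ω → ℝ) (hmeas : ∀ n, Measurable (ε n)) (hindep : iIndepFun ε μ)
    (hident : ∀ n, IdentDistrib (ε n) (ε 0) μ μ) (hmem : ∀ n, ∀ᵐ ω ∂μ, ε n ω ∈ I₁)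
    -- (A1)
    (hA1 : ∀ t ∈ Θ, BijOn (φ t) I₁ I₂ ∧ StrictMonoOn (φ t) I₁)
    -- (A2)
    (hA2 : ∀ x ∈ I₂, ContDiffOn ℝ 1 (fun t => WarpRM.inv I₁ φ t x) Θ)
    -- (A3)
    (hA3 : ∀ t ∈ Θ, MemLp (fun ω => WarpRM.inv I₁ φ t (φ θ (ε 0 ω))) 2 μ)
    -- (A4)
    (hA4 : ∀ B : Set ℝ, IsCompact B → B ⊆ Θ →
      WarpRM.supMoment μ (WarpRM.dInv Θ I₁ φ) (fun ω => φ θ (ε 0 ω)) B 4 < ∞)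
    -- (A5)
    (hA5 : ∀ t ∈ Icc a b, t ≠ θ → 0 < (t - θ) * WarpRM.dContrast μ Θ I₁ φ θ (ε 0) t)
    -- (A6)
    (hA6 : ∀ x ∈ I₂, DifferentiableOn ℝ (fun t => WarpRM.dInv Θ I₁ φ t x) Θ)
    (hA6' : ∀ B : Set ℝ, IsCompact B → B ⊆ Θ →
      WarpRM.supMoment μ (WarpRM.d2Inv Θ I₁ φ) (fun ω => φ θ (ε 0 ω)) B 2 < ∞)
    -- curvature at the true parameter, and the moment of order `α > 4`
    (hM : 1 / 2 < WarpRM.d2Contrast μ Θ I₁ φ θ (ε 0) θ)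
    (α : ℝ) (hα : 4 < α)
    (hmoment : ∀ B : Set ℝ, IsCompact B → B ⊆ Θ →
      WarpRM.supMoment μ (WarpRM.dInv Θ I₁ φ) (fun ω => φ θ (ε 0 ω)) B α < ∞)
    -- the deterministic initial value and the algorithm with steps `γ_n = 1 / n`
    (x₀ : ℝ) (hx₀ : x₀ ∈ Icc a b)
    (θhat : ℕ → Ω → ℝ)
    (hθhat : θhat = WarpRM.estimator Θ I₁ φ θ a b (fun n => 1 / (n : ℝ)) x₀ ε) :
    TendstoInDistribution (fun (n : ℕ) ω => √(n : ℝ) * (θhat n ω - θ)) atTop (id : ℝ → ℝ)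
        (fun _ => μ) (Measure.dirac 0) ∧
      -- the second claim, under (A7)
      ((∀ t ∈ Icc a b, 1 / 2 ≤ WarpRM.d2Contrast μ Θ I₁ φ θ (ε 0) t) →
        ∀ n : ℕ, Integrable (fun ω => (θhat n ω - θ) ^ 2) μ ∧
          ∫ ω, (θhat n ω - θ) ^ 2 ∂μ ≤
            (x₀ - θ) ^ 2 *
              (Real.exp
                (4 * (WarpRM.supMoment μ (WarpRM.dInv Θ I₁ φ) (fun ω => φ θ (ε 0 ω))
                  (Icc a b) 4).toReal * Real.pi ^ 2 / 6) / ((n : ℝ) + 1))) := by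
  subst hθhat
  have hθI : θ ∈ Icc a b := Ioo_subset_Icc_self hθ
  have hab : a < b := hθ.1.trans hθ.2
  have hsub : Icc a b ⊆ Θ := hΘ.out ha hb
  have hθΘ : θ ∈ Θ := hsub hθI
  have hu : UniqueDiffOn ℝ Θ := uniqueDiffOn_of_ordConnected hΘ ha hb hab
  obtain ⟨ξ, hξm, hξi, hξlaw, hξε⟩ := exists_iid_version hmeas hindep hident hmem
  have hε₀ : ∀ᵐ ω ∂μ, ε 0 ω = ξ 0 ω := hξε.mono fun ω hω => hω 0
  have hH := measurable_increment_proj (θ := θ) hu hA1 hA2 hθΘ hab.le hsub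
  set H : ℝ → I₁ → ℝ := fun t e => increment Θ I₁ φ θ (proj a b t) e with hHdef
  have hHt : ∀ t, Measurable (H t) := fun t => hH.of_uncurry_left
  set L := supMoment μ (dInv Θ I₁ φ) (fun ω => φ θ (ε 0 ω)) (Icc a b) 4 with hL
  have hLtop : L < ∞ := hA4 _ isCompact_Icc hsub
  have hLξ : L = supMoment μ (dInv Θ I₁ φ) (fun ω => φ θ (ξ 0 ω)) (Icc a b) 4 :=
    supMoment_congr (hε₀.mono fun ω hω => by simp only [hω]) _ _
  set C : ℝ := 4 * L.toReal with hCdef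
  have hC : 0 ≤ C := by positivity
  set g := dContrast μ Θ I₁ φ θ (ε 0) with hg
  have hgI : ∀ t ∈ Icc a b, g t = ∫ ω, increment Θ I₁ φ θ t (ξ 0 ω) ∂μ := fun t ht =>
    (hasDerivWithinAt_contrast hΘ hu hA1 hA2 hA4 hθΘ (hξm 0) hε₀ (hsub ht)).derivWithin
      (hu t (hsub ht))
  have hgH : ∀ t ∈ Icc a b, g t = ∫ e, H t e ∂(μ.map (ξ 0)) := fun t ht => by
    rw [integral_map (hξm 0).aemeasurable (hHt t).aestronglyMeasurable, hgI t ht]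
    simp only [hHdef, proj_eq_self ht]
  have hgcont : ContinuousOn g (Icc a b) :=
    (continuousOn_integral_increment_noise hu hA1 hA2 hsub (hLξ ▸ hLtop) hθI (hξm 0)).congr hgI
  have hgθ : g θ = 0 := by
    rw [hgI θ hθI]
    simp only [increment, inv_apply (hA1 θ hθΘ).1 (Subtype.coe_prop _), sub_self, mul_zero,
      integral_zero]
  have h2 : ∀ t ∈ Icc a b, ∫⁻ e, ENNReal.ofReal (H t e ^ 2) ∂(μ.map (ξ 0)) ≤
      ENNReal.ofReal (C * (t - θ) ^ 2) := fun t ht => by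
    rw [lintegral_map ((hHt t).pow_const 2).ennreal_ofReal (hξm 0)]
    simp only [hHdef, proj_eq_self ht]
    refine (lintegral_sq_increment_noise_le hA1 hu hA2 hsub hθI ht).trans (le_of_eq ?_)
    rw [← hLξ, ← ENNReal.ofReal_toReal hLtop.ne, ← ENNReal.ofReal_mul (by positivity), hCdef]
    congr 1
    ring
  have hest : ∀ᵐ ω ∂μ, ∀ n, estimator Θ I₁ φ θ a b (fun n => 1 / (n : ℝ)) x₀ ε n ω =
      robbinsMonro a b (fun n => 1 / (n : ℝ)) H x₀ ξ n ω :=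
    hξε.mono fun ω hω n => estimator_eq_robbinsMonro hab.le hx₀ hω n
  -- `derivWithin` is `0` where the derivative does not exist, so a nonzero value of `M''` already
  -- certifies that `M'` is differentiable there.
  have hderg : ∀ t ∈ Θ, d2Contrast μ Θ I₁ φ θ (ε 0) t ≠ 0 →
      HasDerivWithinAt g (d2Contrast μ Θ I₁ φ θ (ε 0) t) Θ t := fun t _ h =>
    (differentiableWithinAt_of_derivWithin_ne_zero h).hasDerivWithinAt
  constructor
  · have hdθ := (hderg θ hθΘ (by linarith)).hasDerivAt
      (mem_of_superset (Icc_mem_nhds hθ.1 hθ.2) hsub)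
    -- Room is left on both sides of `m`: below `M''(θ)` for the local slope, above `1/2` for the
    -- rate.
    obtain ⟨m, hm, hm'⟩ := exists_between hM
    obtain ⟨δ, hδ, hloc⟩ := exists_mul_sq_le hgθ hdθ hm'
    obtain ⟨c, hc, hglob⟩ := exists_global_mul_sq_le hθ hgcont hA5 (by linarith) hδ
      fun t _ => hloc t
    have hlim := tendstoInMeasure_sqrt_mul_robbinsMonro hξm hξi hξlaw hH hθI hC hx₀ h2 hc
      (fun t ht => hgH t ht ▸ hglob t ht) hm hδ fun t ht h => hgH t ht ▸ hloc t h
    refine TendstoInDistribution.congr (fun n => hest.mono fun ω hω => ?_) EventuallyEq.rfl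
      (tendstoInDistribution_dirac_of_tendstoInMeasure (fun n => ?_) hlim)
    · simp only [hω]
    · exact ((((measurable_robbinsMonro hH n).mono (past_le hξm n) le_rfl).sub_const
        θ).const_mul _).aemeasurable
  · intro hA7 n
    -- The rate `c = 1/2` turns `(n + 1)^(-2c)` into `1 / (n + 1)`.
    have hglob : ∀ t ∈ Icc a b, 1 / 2 * (t - θ) ^ 2 ≤ (t - θ) * g t := fun t ht =>
      mul_sq_le_of_le_derivWithin hθI (fun s hs =>
        (hderg s (hsub hs) (by linarith [hA7 s hs])).mono hsub) hA7 hgθ ht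
    have hsq : (fun ω => (estimator Θ I₁ φ θ a b (fun n => 1 / (n : ℝ)) x₀ ε n ω - θ) ^ 2) =ᵐ[μ]
        fun ω => (robbinsMonro a b (fun n => 1 / (n : ℝ)) H x₀ ξ n ω - θ) ^ 2 :=
      hest.mono fun ω hω => by simp only [hω]
    refine ⟨(integrable_sq_robbinsMonro hξm hH hab.le hx₀ _ n).congr hsq.symm, ?_⟩
    rw [integral_congr_ae hsq]
    refine (integral_sq_robbinsMonro_le hξm hξi hξlaw hH hθI hC hx₀ h2
      (fun t ht => hgH t ht ▸ hglob t ht) n).trans ?_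
    rw [mul_comm]
    refine mul_le_mul_of_nonneg_left ((decay_le hC (by norm_num) n).trans (le_of_eq ?_))
      (sq_nonneg _)
    rw [show -(2 * (1 / 2 : ℝ)) = -1 by norm_num, Real.rpow_neg_one, ← div_eq_mul_inv]
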